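/- Let $\mathcal B$ be a Krull--Schmidt exact category (in the sense of Quillen; the class of short exact sequences is stable under isomorphisms, direct sums and direct summands) with enough projectives and enough injectives. A cotorsion pair on $\mathcal B$ is a pair $(\mathcal U,\mathcal V)$ of full additive subcategories of $\mathcal B$, closed under direct summands, such that $\operatorname{Ext}^1_{\mathcal B}(\mathcal U,\mathcal V)=0$ and every $B\in\mathcal B$ admits short exact sequences $V_B\rightarrowtail U_B\twoheadrightarrow B$ and $B\rightarrowtail V^B\twoheadrightarrow U^B$ with $U_B,U^B\in\mathcal U$ and $V_B,V^B\in\mathcal V$. Let $(\mathcal S,\mathcal T),(\mathcal U,\mathcal V)$ be a twin cotorsion pair on $\mathcal B$, i.e. two cotorsion pairs with $\mathcal S\subseteq\mathcal U$. Put $\mathcal W=\mathcal T\cap\mathcal U$. Let $\mathcal B^+$ be the full subcategory of the objects $B$ admitting a short exact sequence $V\rightarrowtail W\twoheadrightarrow B$ with $W\in\mathcal W$, $V\in\mathcal V$, let $\mathcal B^-$ be the full subcategory of the objects $B$ admitting a short exact sequence $B\rightarrowtail W\twoheadrightarrow S$ with $W\in\mathcal W$, $S\in\mathcal S$, and let $\mathcal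 H=\mathcal B^+\cap\mathcal B^-$. The heart $\underline{\mathcal H}=\mathcal H/\mathcal W$ is the quotient of $\mathcal H$ by the ideal of morphisms that factor through an object of $\mathcal W$. Suppose that $\mathcal U\subseteq\mathcal T$ or $\mathcal T\subseteq\mathcal U$. Then the heart $\underline{\mathcal H}$ is integral and almost abelian. That is, $\underline{\mathcal H}$ is preabelian (additive, and every morphism has a kernel and a cokernel) and the following hold. For every pull-back square in $\underline{\mathcal H}$ with $\alpha:A\to B$, $\beta:A\to C$, $\gamma:B\to D$, $\delta:C\to D$ and $\gamma\alpha=\delta\beta$: if $\delta$ is an epimorphism then $\alpha$ is an epimorphism, and if $\delta$ is a cokernel (of some morphism) then $\alpha$ is a cokernel. Dually, for every push-out square in $\underline{\mathcal H}$ with $\delta:D\to C$, $\gamma:D\to B$, $\alpha:B\to A$, $\beta:C\to A$ and $\alpha\gamma=\beta\delta$: if $\delta$ is a monomorphism then $\alpha$ is a monomorphism, and if $\delta$ is a kernel (of some morphism) then $\alpha$ is a kernel. -/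

import Mathlib

open CategoryTheory CategoryTheory.Limits

universe v u

attribute [local instance] hasBinaryBiproducts_of_finite_biproducts

namespace TwinCotorsion

/-! ### Exact categories -/

section Exact

variable (C : Type u) [Category.{v} C] [Preadditive C] [HasFiniteBiproducts C]

/-- A Quillen exact structure on an additive category: a class of kernel-cokernel pairs
(called conflations, or short exact sequences), stable under isomorphisms, direct sums and direct
summands, such that identities are inflations and deflations, inflations and deflations are
closed under composition, pull-backs of deflations along arbitrary morphisms exist and are
deflations, and push-outs of inflations along arbitrary morphisms exist and are inflations. -/
structure ExactStructure where
  /-- The class of short exact sequences. -/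
  conflation : ShortComplex C → Prop
  isKernel : ∀ S, conflation S → Nonempty (IsLimit (KernelFork.ofι S.f S.zero))
  isCokernel : ∀ S, conflation S → Nonempty (IsColimit (CokernelCofork.ofπ S.g S.zero))
  of_iso : ∀ {S₁ S₂ : ShortComplex C}, (S₁ ≅ S₂) → conflation S₁ → conflation S₂
  directSum : ∀ S₁ S₂ : ShortComplex C, conflation S₁ → conflation S₂ →
    conflation (ShortComplex.mk (biprod.map S₁.f S₂.f) (biprod.map S₁.g S₂.g)
      (by ext <;> simp))
  directSummand : ∀ S₁ S₂ : ShortComplex C,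
    conflation (ShortComplex.mk (biprod.map S₁.f S₂.f) (biprod.map S₁.g S₂.g)
      (by ext <;> simp)) → conflation S₁
  id_inflation : ∀ X : C, ∃ (Z : C) (d : X ⟶ Z) (w : 𝟙 X ≫ d = 0),
    conflation (ShortComplex.mk (𝟙 X) d w)
  id_deflation : ∀ X : C, ∃ (Z : C) (i : Z ⟶ X) (w : i ≫ 𝟙 X = 0),
    conflation (ShortComplex.mk i (𝟙 X) w)
  comp_inflation : ∀ {X Y Y' : C} (i : X ⟶ Y) (j : Y ⟶ Y'),
    (∃ (Z : C) (d : Y ⟶ Z) (w : i ≫ d = 0), conflation (ShortComplex.mk i d w)) →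
    (∃ (Z : C) (d : Y' ⟶ Z) (w : j ≫ d = 0), conflation (ShortComplex.mk j d w)) →
    ∃ (Z : C) (d : Y' ⟶ Z) (w : (i ≫ j) ≫ d = 0), conflation (ShortComplex.mk (i ≫ j) d w)
  comp_deflation : ∀ {Y' Y Z : C} (e : Y' ⟶ Y) (d : Y ⟶ Z),
    (∃ (X : C) (i : X ⟶ Y') (w : i ≫ e = 0), conflation (ShortComplex.mk i e w)) →
    (∃ (X : C) (i : X ⟶ Y) (w : i ≫ d = 0), conflation (ShortComplex.mk i d w)) →
    ∃ (X : C) (i : X ⟶ Y') (w : i ≫ e ≫ d = 0), conflation (ShortComplex.mk i (e ≫ d) w)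
  pullback_deflation : ∀ S : ShortComplex C, conflation S → ∀ {Z' : C} (f : Z' ⟶ S.X₃),
    ∃ (Y' : C) (f' : Y' ⟶ S.X₂) (d' : Y' ⟶ Z'), IsPullback f' d' S.g f ∧
      ∃ (X : C) (i : X ⟶ Y') (w : i ≫ d' = 0), conflation (ShortComplex.mk i d' w)
  pushout_inflation : ∀ S : ShortComplex C, conflation S → ∀ {X' : C} (g : S.X₁ ⟶ X'),
    ∃ (Y' : C) (g' : S.X₂ ⟶ Y') (i' : X' ⟶ Y'), IsPushout S.f g g' i' ∧
      ∃ (Z : C) (d : Y' ⟶ Z) (w : i' ≫ d = 0), conflation (ShortComplex.mk i' d w)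

/-- A category is Krull-Schmidt if every object is a finite direct sum of objects with local
endomorphism rings. -/
def IsKrullSchmidt : Prop :=
  ∀ X : C, ∃ (n : ℕ) (Y : Fin n → C),
    (∀ i, IsLocalRing (End (Y i))) ∧ Nonempty (X ≅ ⨁ Y)

end Exact

section

variable {C : Type u} [Category.{v} C] [Preadditive C] [HasFiniteBiproducts C]

namespace ExactStructure

variable (E : ExactStructure C)

/-- `d` is a deflation. -/
def IsDeflation {Y Z : C} (d : Y ⟶ Z) : Prop :=
  ∃ (X : C) (i : X ⟶ Y) (w : i ≫ d = 0), E.conflation (ShortComplex.mk i d w)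

/-- `i` is an inflation. -/
def IsInflation {X Y : C} (i : X ⟶ Y) : Prop :=
  ∃ (Z : C) (d : Y ⟶ Z) (w : i ≫ d = 0), E.conflation (ShortComplex.mk i d w)

/-- `P` is projective relative to the exact structure. -/
def IsProjective (P : C) : Prop :=
  ∀ {X Y : C} (f : X ⟶ Y), E.IsDeflation f → ∀ g : P ⟶ Y, ∃ h : P ⟶ X, h ≫ f = g

/-- `I` is injective relative to the exact structure. -/
def IsInjective (I : C) : Prop :=
  ∀ {X Y : C} (f : X ⟶ Y), E.IsInflation f → ∀ g : X ⟶ I, ∃ h : Y ⟶ I, f ≫ h = g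

/-- Every object is the target of a deflation from a projective object. -/
def EnoughProjectives : Prop :=
  ∀ X : C, ∃ (P : C) (p : P ⟶ X), E.IsProjective P ∧ E.IsDeflation p

/-- Every object is the source of an inflation to an injective object. -/
def EnoughInjectives : Prop :=
  ∀ X : C, ∃ (I : C) (i : X ⟶ I), E.IsInjective I ∧ E.IsInflation i

/-- `∃` a short exact sequence `A ↣ B ↠ D` with the given objects. -/
def HasConflation (A B D : C) : Prop :=
  ∃ (i : A ⟶ B) (d : B ⟶ D) (w : i ≫ d = 0), E.conflation (ShortComplex.mk i d w)

/-- `Ext¹(A, B) = 0`: every extension of `A` by `B`, that is, every short exact sequence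
`B ↣ M ↠ A`, represents the trivial class, i.e. splits. -/
def ExtVanishes (A B : C) : Prop :=
  ∀ (M : C) (i : B ⟶ M) (d : M ⟶ A) (w : i ≫ d = 0),
    E.conflation (ShortComplex.mk i d w) → Nonempty (ShortComplex.mk i d w).Splitting

end ExactStructure

/-- A class of objects which spans a full additive subcategory closed under direct summands (and
hence under isomorphisms, as `A ≅ X` exhibits `A` as a direct summand `X ≅ A ⊞ 0` of `X`). -/
structure IsAdditiveSubcategory (P : ObjectProperty C) : Prop where
  zero : ∃ Z : C, IsZero Z ∧ P Z
  biprod : ∀ A B : C, P A → P B → P (A ⊞ B)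
  summand : ∀ A B X : C, Nonempty (X ≅ A ⊞ B) → P X → P A

/-- Cotorsion pairs in an exact category. -/
structure CotorsionPair (E : ExactStructure C) where
  /-- The first class of the pair. -/
  left : ObjectProperty C
  /-- The second class of the pair. -/
  right : ObjectProperty C
  additive_left : IsAdditiveSubcategory left
  additive_right : IsAdditiveSubcategory right
  ext_vanishes : ∀ A B : C, left A → right B → E.ExtVanishes A B
  exists_deflation : ∀ B : C, ∃ V₀ U₀ : C, right V₀ ∧ left U₀ ∧ E.HasConflation V₀ U₀ B
  exists_inflation : ∀ B : C, ∃ V₀ U₀ : C, right V₀ ∧ left U₀ ∧ E.HasConflation B V₀ U₀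

/-- Twin cotorsion pairs `(S, T), (U, V)`: two cotorsion pairs with `S ⊆ U`. -/
structure TwinCotorsionPair (E : ExactStructure C) where
  /-- The cotorsion pair `(S, T)`. -/
  fst : CotorsionPair E
  /-- The cotorsion pair `(U, V)`. -/
  snd : CotorsionPair E
  le : fst.left ≤ snd.left

namespace TwinCotorsionPair

variable {E : ExactStructure C} (D : TwinCotorsionPair E)

/-- The class `S` of a twin cotorsion pair `(S, T), (U, V)`. -/
abbrev S : ObjectProperty C := D.fst.left

/-- The class `T` of a twin cotorsion pair `(S, T), (U, V)`. -/
abbrev T : ObjectProperty C := D.fst.right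

/-- The class `U` of a twin cotorsion pair `(S, T), (U, V)`. -/
abbrev U : ObjectProperty C := D.snd.left

/-- The class `V` of a twin cotorsion pair `(S, T), (U, V)`. -/
abbrev V : ObjectProperty C := D.snd.right

/-- `W = T ∩ U`. -/
def W : ObjectProperty C := fun X => D.T X ∧ D.U X

/-- `B⁺`: the objects `B` admitting a short exact sequence `V₀ ↣ W₀ ↠ B` with `W₀ ∈ W` and
`V₀ ∈ V`. -/
def plus : ObjectProperty C := fun B =>
  ∃ V₀ W₀ : C, D.V V₀ ∧ D.W W₀ ∧ E.HasConflation V₀ W₀ B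

/-- `B⁻`: the objects `B` admitting a short exact sequence `B ↣ W₀ ↠ S₀` with `W₀ ∈ W` and
`S₀ ∈ S`. -/
def minus : ObjectProperty C := fun B =>
  ∃ W₀ S₀ : C, D.W W₀ ∧ D.S S₀ ∧ E.HasConflation B W₀ S₀

/-- `H = B⁺ ∩ B⁻`. -/
def H : ObjectProperty C := fun B => D.plus B ∧ D.minus B

/-- Two morphisms of `H` are identified if their difference factors through an object of `W`. -/
def heartRel : HomRel D.H.FullSubcategory := fun X Y f g =>
  ∃ (Z : C) (a : X.obj ⟶ Z) (b : Z ⟶ Y.obj), D.W Z ∧ a ≫ b = f.hom - g.hom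

theorem heartRel_add ⦃X Y : D.H.FullSubcategory⦄ (f₁ f₂ g₁ g₂ : X ⟶ Y)
    (hf : D.heartRel f₁ f₂) (hg : D.heartRel g₁ g₂) : D.heartRel (f₁ + g₁) (f₂ + g₂) := by
  obtain ⟨Z, a, b, hZ, h⟩ := hf
  obtain ⟨Z', a', b', hZ', h'⟩ := hg
  refine ⟨Z ⊞ Z', biprod.lift a a', biprod.desc b b',
    ⟨D.fst.additive_right.biprod _ _ hZ.1 hZ'.1, D.snd.additive_left.biprod _ _ hZ.2 hZ'.2⟩, ?_⟩
  rw [biprod.lift_desc, h, h']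
  change f₁.hom - f₂.hom + (g₁.hom - g₂.hom) = (f₁.hom + g₁.hom) - (f₂.hom + g₂.hom)
  abel

theorem heartRel_refl ⦃X Y : D.H.FullSubcategory⦄ (f : X ⟶ Y) : D.heartRel f f := by
  obtain ⟨Z, hZ, hT⟩ := D.fst.additive_right.zero
  obtain ⟨Z', hZ', hU⟩ := D.snd.additive_left.zero
  have e : Z ≅ Z' ⊞ Z := hZ.iso (by
    rw [IsZero.iff_id_eq_zero]
    ext
    · exact hZ'.eq_of_src _ _
    · exact hZ'.eq_of_src _ _
    · exact hZ.eq_of_src _ _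
    · exact hZ.eq_of_src _ _)
  exact ⟨Z', 0, 0, ⟨D.fst.additive_right.summand Z' Z Z ⟨e⟩ hT, hU⟩, by simp⟩

instance : Congruence D.heartRel where
  equivalence :=
    { refl := fun f => D.heartRel_refl f
      symm := by
        rintro f g ⟨Z, a, b, hZ, h⟩
        exact ⟨Z, -a, b, hZ, by simp [h]⟩
      trans := by
        intro f g k h₁ h₂
        obtain ⟨Z, a, b, hZ, h⟩ := D.heartRel_add _ _ _ _ h₁ h₂
        refine ⟨Z, a, b, hZ, h.trans ?_⟩
        change (f.hom + g.hom) - (g.hom + k.hom) = f.hom - k.hom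
        abel }
  comp_left := by
    rintro X Y Z f g g' ⟨M, a, b, hM, h⟩
    exact ⟨M, f.hom ≫ a, b, hM, by simp [h]⟩
  comp_right := by
    rintro X Y Z f f' g ⟨M, a, b, hM, h⟩
    exact ⟨M, a, b ≫ g.hom, hM, by rw [← Category.assoc, h]; simp⟩

/-- The heart `H / W` of a twin cotorsion pair: the full subcategory of objects of `H`, modulo the
ideal of the morphisms that factor through an object of `W`. -/
abbrev Heart : Type u := CategoryTheory.Quotient D.heartRel

instance : Preadditive D.Heart :=
  CategoryTheory.Quotient.preadditive D.heartRel D.heartRel_add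

end TwinCotorsionPair

end

/-! ### Classes of preabelian categories -/

section Preabelian

variable (A : Type u) [Category.{v} A] [Preadditive A]

/-- An additive category in which every morphism has a kernel and a cokernel. -/
structure IsPreabelian : Prop where
  hasFiniteBiproducts : HasFiniteBiproducts A
  hasKernels : HasKernels A
  hasCokernels : HasCokernels A

/-- Pull-backs of epimorphisms are epimorphisms, and push-outs of monomorphisms are
monomorphisms. -/
structure IsIntegral : Prop extends IsPreabelian A where
  left : ∀ {X B Y Z : A} (α : X ⟶ B) (β : X ⟶ Y) (γ : B ⟶ Z) (δ : Y ⟶ Z),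
    IsPullback α β γ δ → Epi δ → Epi α
  right : ∀ {X B Y Z : A} (α : B ⟶ X) (β : Y ⟶ X) (γ : Z ⟶ B) (δ : Z ⟶ Y),
    IsPushout γ δ α β → Mono δ → Mono α

/-- Pull-backs of cokernels are cokernels, and push-outs of kernels are kernels. Here a morphism
is called a cokernel (a kernel) if it is the cokernel (the kernel) of some morphism. -/
structure IsAlmostAbelian : Prop extends IsPreabelian A where
  left : ∀ {X B Y Z : A} (α : X ⟶ B) (β : X ⟶ Y) (γ : B ⟶ Z) (δ : Y ⟶ Z),
    IsPullback α β γ δ → Nonempty (NormalEpi δ) → Nonempty (NormalEpi α)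
  right : ∀ {X B Y Z : A} (α : B ⟶ X) (β : Y ⟶ X) (γ : Z ⟶ B) (δ : Z ⟶ Y),
    IsPushout γ δ α β → Nonempty (NormalMono δ) → Nonempty (NormalMono α)

end Preabelian

end TwinCotorsion

/-! The conclusion is self-dual. Passing to opposites turns the twin pair into `(Vᵒᵖ, Uᵒᵖ), (Tᵒᵖ,
Sᵒᵖ)`, which exchanges the two inclusions and exchanges injectives with projectives, so it suffices
to treat `U ⊆ T`.

Then `W = U`, every object is in `B⁺`, and `X ∈ H` means that there is a conflation `X ↣ U₀ ↠ S₀`.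
The engine is the vanishing of `Ext¹(S, U)`, `Ext¹(S, V)` and `Ext¹(U, V)`. A cokernel of `X ⟶ Y` in
the heart is the pushout of `X ↣ U₀`. A kernel is the pullback of a deflation `U₀ ↠ Y` with kernel
in `V`, followed by a coreflection into `H` (`exists_coreflection`). Hence, up to isomorphism,
normal epimorphisms are the inflations with cokernel in `S` and normal monomorphisms are the
deflations with kernel in `V` (`exists_conf_of_normalEpi`, `exists_conf_of_normalMono`, with
converses `normalEpi_hMap`, `normalMono_hMap`).

Almost abelian: after adding a summand from `U`, which is invisible in the heart, the relevant
pushouts and pullbacks become honest ones in the exact category. These preserve the kernel of a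
deflation and the cokernel of an inflation.

Integral: let `Q ↣ P ↠ S₀` be a syzygy of an object of `S`, with `P` projective. Maps from `Q` lift
along epimorphisms of the heart (`exists_lift_of_epi`), and every object of the heart has an
epimorphism from such a `Q` (`exists_epi`). Both halves of integrality can be tested on these
covers. -/

namespace TwinCotorsion

/-! ### Conflations: pushouts, pullbacks, and splitting. -/

section

variable {C : Type u} [Category.{v} C] [Preadditive C] [HasFiniteBiproducts C]

namespace ExactStructure

variable (E : ExactStructure C)

/-- `i` and `d` form a short exact sequence. -/
def Conf {X Y Z : C} (i : X ⟶ Y) (d : Y ⟶ Z) : Prop :=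
  ∃ w : i ≫ d = 0, E.conflation (ShortComplex.mk i d w)

variable {E}

namespace Conf

variable {X Y Z : C} {i : X ⟶ Y} {d : Y ⟶ Z}

theorem w (h : E.Conf i d) : i ≫ d = 0 := h.1

theorem isInflation (h : E.Conf i d) : E.IsInflation i := ⟨_, _, h.1, h.2⟩

theorem isDeflation (h : E.Conf i d) : E.IsDeflation d := ⟨_, _, h.1, h.2⟩

theorem mono (h : E.Conf i d) : Mono i := by
  obtain ⟨l⟩ := E.isKernel _ h.2
  exact ⟨fun a b e => Fork.IsLimit.hom_ext l e⟩

theorem epi (h : E.Conf i d) : Epi d := by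
  obtain ⟨l⟩ := E.isCokernel _ h.2
  exact ⟨fun a b e => Cofork.IsColimit.hom_ext l e⟩

theorem lift (h : E.Conf i d) {A : C} (f : A ⟶ Y) (hf : f ≫ d = 0) : ∃ l : A ⟶ X, l ≫ i = f := by
  obtain ⟨l⟩ := E.isKernel _ h.2
  exact ⟨_, (KernelFork.IsLimit.lift' l f hf).2⟩

theorem desc (h : E.Conf i d) {A : C} (f : Y ⟶ A) (hf : i ≫ f = 0) : ∃ l : Z ⟶ A, d ≫ l = f := by
  obtain ⟨l⟩ := E.isCokernel _ h.2
  exact ⟨_, (CokernelCofork.IsColimit.desc' l f hf).2⟩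

theorem of_isos (h : E.Conf i d) {X' Y' Z' : C} {i' : X' ⟶ Y'} {d' : Y' ⟶ Z'} (e₁ : X ≅ X')
    (e₂ : Y ≅ Y') (e₃ : Z ≅ Z') (h₁ : e₁.hom ≫ i' = i ≫ e₂.hom) (h₂ : e₂.hom ≫ d' = d ≫ e₃.hom) :
    E.Conf i' d' := by
  have w : i' ≫ d' = 0 := by
    rw [← cancel_epi e₁.hom, reassoc_of% h₁, h₂, reassoc_of% h.w, zero_comp, comp_zero]
  exact ⟨w, E.of_iso (ShortComplex.isoMk (S₂ := ShortComplex.mk i' d' w) e₁ e₂ e₃ h₁ h₂) h.2⟩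

/-- The inflation comes with some conflation, and its deflation is another cokernel of `i`;
uniqueness of cokernels and closure under isomorphism do the rest. -/
theorem of_cokernel (hi : E.IsInflation i) (w : i ≫ d = 0) (hd : Epi d)
    (hdesc : ∀ {A : C} (f : Y ⟶ A), i ≫ f = 0 → ∃ l : Z ⟶ A, d ≫ l = f) : E.Conf i d := by
  obtain ⟨Z', d', w', h⟩ := hi
  have h' : E.Conf i d' := ⟨w', h⟩
  obtain ⟨a, ha⟩ := h'.desc d w
  obtain ⟨b, hb⟩ := hdesc d' w'
  have := h'.epi
  refine h'.of_isos (Iso.refl _) (Iso.refl _) ⟨a, b, ?_, ?_⟩ ?_ ?_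
  · rw [← cancel_epi d', reassoc_of% ha, hb, Category.comp_id]
  · rw [← cancel_epi d, reassoc_of% hb, ha, Category.comp_id]
  · simp
  · simp [ha]

theorem of_kernel (hd : E.IsDeflation d) (w : i ≫ d = 0) (hi : Mono i)
    (hlift : ∀ {A : C} (f : A ⟶ Y), f ≫ d = 0 → ∃ l : A ⟶ X, l ≫ i = f) : E.Conf i d := by
  obtain ⟨X', i', w', h⟩ := hd
  have h' : E.Conf i' d := ⟨w', h⟩
  obtain ⟨a, ha⟩ := h'.lift i w
  obtain ⟨b, hb⟩ := hlift i' w'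
  have := h'.mono
  refine h'.of_isos ⟨b, a, ?_, ?_⟩ (Iso.refl _) (Iso.refl _) ?_ ?_
  · rw [← cancel_mono i', Category.assoc, ha, hb, Category.id_comp]
  · rw [← cancel_mono i, Category.assoc, hb, ha, Category.id_comp]
  · simp [hb]
  · simp

/-- The axiom provides only some cokernel for the new inflation. The map induced by `d` and `0` is
also a cokernel, so the end term `Z` is unchanged. -/
theorem exists_pushout (h : E.Conf i d) {X' : C} (f : X ⟶ X') :
    ∃ (Y' : C) (f' : Y ⟶ Y') (i' : X' ⟶ Y') (d' : Y' ⟶ Z),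
      IsPushout i f f' i' ∧ E.Conf i' d' ∧ f' ≫ d' = d := by
  obtain ⟨Y', f', i', hp, hi'⟩ := E.pushout_inflation _ h.2 f
  dsimp at f' hp
  have h0 : i ≫ d = f ≫ (0 : X' ⟶ Z) := by rw [h.w, comp_zero]
  have := h.epi
  refine ⟨Y', f', i', hp.desc d 0 h0, hp, of_cokernel hi' (hp.inr_desc _ _ _) ?_ ?_,
    hp.inl_desc _ _ _⟩
  · exact epi_of_epi_fac (hp.inl_desc d 0 h0)
  · intro A g hg
    obtain ⟨l, hl⟩ := h.desc (f' ≫ g) (by rw [hp.w_assoc, hg, comp_zero])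
    exact ⟨l, hp.hom_ext (by simpa using hl) (by simp [hg])⟩

theorem exists_pullback (h : E.Conf i d) {Z' : C} (f : Z' ⟶ Z) :
    ∃ (Y' : C) (f' : Y' ⟶ Y) (d' : Y' ⟶ Z') (i' : X ⟶ Y'),
      IsPullback f' d' d f ∧ E.Conf i' d' ∧ i' ≫ f' = i := by
  obtain ⟨Y', f', d', hp, hd'⟩ := E.pullback_deflation _ h.2 f
  dsimp at f' hp
  have h0 : i ≫ d = (0 : X ⟶ Z') ≫ f := by rw [h.w, zero_comp]
  have := h.mono
  refine ⟨Y', f', d', hp.lift i 0 h0, hp, of_kernel hd' (hp.lift_snd _ _ _) ?_ ?_,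
    hp.lift_fst _ _ _⟩
  · exact mono_of_mono_fac (hp.lift_fst i 0 h0)
  · intro A g hg
    obtain ⟨l, hl⟩ := h.lift (g ≫ f') (by rw [Category.assoc, hp.w, reassoc_of% hg, zero_comp])
    exact ⟨l, hp.hom_ext (by simpa using hl) (by simp [hg])⟩

/-- The pushout of a deflation along an inflation is a deflation with the same kernel. -/
theorem of_isPushout {K A M B N : C} {k : K ⟶ A} {p : A ⟶ B} {j : A ⟶ M} {p' : M ⟶ N}
    {j' : B ⟶ N} (hp : IsPushout j p p' j') (h : E.Conf k p) (hj : E.IsInflation j) :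
    E.Conf (k ≫ j) p' := by
  have := h.epi
  refine of_cokernel (E.comp_inflation k j h.isInflation hj) ?_ hp.epi_inl_of_epi ?_
  · rw [Category.assoc, hp.w, reassoc_of% h.w, zero_comp]
  · intro A g hg
    obtain ⟨l, hl⟩ := h.desc (j ≫ g) (by rw [← Category.assoc, hg])
    exact ⟨hp.desc g l hl.symm, hp.inl_desc _ _ _⟩

/-- The pullback of an inflation along a deflation is an inflation with the same cokernel. -/
theorem of_isPullback {K M A Q B : C} {i : A ⟶ B} {c : B ⟶ Q} {p : M ⟶ B} {i' : K ⟶ M}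
    {p' : K ⟶ A} (hp : IsPullback i' p' p i) (h : E.Conf i c) (hd : E.IsDeflation p) :
    E.Conf i' (p ≫ c) := by
  have := h.mono
  refine of_kernel (E.comp_deflation p c hd h.isDeflation) ?_ hp.mono_fst_of_mono ?_
  · rw [hp.w_assoc, h.w, comp_zero]
  · intro A g hg
    obtain ⟨l, hl⟩ := h.lift (g ≫ p) (by rw [Category.assoc, hg])
    exact ⟨hp.lift g l hl.symm, hp.lift_fst _ _ _⟩

/-- Pushing out along `f` gives an extension of `Z` by `T`, which splits; its retraction yields the
extension of `f`. -/
theorem exists_extension (h : E.Conf i d) {T : C} (hT : E.ExtVanishes Z T) (f : X ⟶ T) :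
    ∃ g : Y ⟶ T, i ≫ g = f := by
  obtain ⟨Y', f', i', d', hp, hc, -⟩ := h.exists_pushout f
  obtain ⟨s⟩ := hT _ i' d' hc.1 hc.2
  exact ⟨f' ≫ s.r, by rw [hp.w_assoc]; exact (congrArg (f ≫ ·) s.f_r).trans (Category.comp_id _)⟩

theorem exists_lifting (h : E.Conf i d) {T : C} (hT : E.ExtVanishes T X) (f : T ⟶ Z) :
    ∃ g : T ⟶ Y, g ≫ d = f := by
  obtain ⟨Y', f', d', i', hp, hc, -⟩ := h.exists_pullback f
  obtain ⟨s⟩ := hT _ i' d' hc.1 hc.2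
  exact ⟨s.s ≫ f', by
    rw [Category.assoc, hp.w, ← Category.assoc]
    exact (congrArg (· ≫ f) s.s_g).trans (Category.id_comp _)⟩

theorem splitting_of_retraction (h : E.Conf i d) (r : Y ⟶ X) (hr : i ≫ r = 𝟙 X) :
    Nonempty (ShortComplex.mk i d h.w).Splitting := by
  obtain ⟨s, hs⟩ := h.desc (𝟙 Y - r ≫ i) (by
    rw [Preadditive.comp_sub, reassoc_of% hr, Category.comp_id, sub_self])
  have := h.epi
  refine ⟨⟨r, s, hr, ?_, ?_⟩⟩
  · dsimp
    rw [← cancel_epi d, reassoc_of% hs, Preadditive.sub_comp, Category.assoc, h.w]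
    simp
  · dsimp
    rw [hs]
    abel

theorem splitting_of_section (h : E.Conf i d) (s : Z ⟶ Y) (hs : s ≫ d = 𝟙 Z) :
    Nonempty (ShortComplex.mk i d h.w).Splitting := by
  obtain ⟨r, hr⟩ := h.lift (𝟙 Y - d ≫ s) (by
    rw [Preadditive.sub_comp, Category.assoc, hs]; simp)
  have := h.mono
  refine h.splitting_of_retraction r ?_
  rw [← cancel_mono i, Category.assoc, hr, Preadditive.comp_sub, reassoc_of% h.w]
  simp

theorem iso_biprod (h : E.Conf i d) (s : Nonempty (ShortComplex.mk i d h.w).Splitting) :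
    Nonempty (Y ≅ X ⊞ Z) := by
  obtain ⟨s⟩ := s
  have h1 := s.f_r
  have h2 := s.s_g
  have h3 := s.id
  have h4 := s.s_r
  have h5 := h.w
  dsimp at h1 h2 h3 h4
  exact ⟨⟨biprod.lift s.r d, biprod.desc i s.s, by simp [h3], by ext <;> simp [*]⟩⟩

end Conf

theorem extVanishes_of_lifting {A B : C}
    (h : ∀ {M : C} {i : B ⟶ M} {d : M ⟶ A}, E.Conf i d → ∃ s : A ⟶ M, s ≫ d = 𝟙 A) :
    E.ExtVanishes A B := fun _ _ _ w hc =>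
  have hc' : E.Conf _ _ := ⟨w, hc⟩
  have ⟨r, hr⟩ := h hc'
  hc'.splitting_of_section r hr

theorem IsInflation.of_isPushout {A M B N : C} {j : A ⟶ M} {p : A ⟶ B} {p' : M ⟶ N}
    {j' : B ⟶ N} (hp : IsPushout j p p' j') (hj : E.IsInflation j) : E.IsInflation j' := by
  obtain ⟨Z, d, w, h⟩ := hj
  obtain ⟨N', p'', j'', d', hp', h', -⟩ := Conf.exists_pushout ⟨w, h⟩ p
  exact (h'.of_isos (Iso.refl _) (hp'.isoIsPushout _ _ hp) (Iso.refl _)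
    (d' := (hp'.isoIsPushout _ _ hp).inv ≫ d') (by simp) (by simp)).isInflation

theorem Conf.exists_kernel_of_isPullback {K A M B N : C} {k : K ⟶ M} {p' : N ⟶ M} {j' : N ⟶ B}
    {j : M ⟶ A} {p : B ⟶ A} (hp : IsPullback p' j' j p) (h : E.Conf k j) :
    ∃ k' : K ⟶ N, E.Conf k' j' := by
  obtain ⟨N', p'', j'', d', hp', h', -⟩ := h.exists_pullback p
  exact ⟨_, h'.of_isos (Iso.refl _) (hp'.isoIsPullback _ _ hp) (Iso.refl _)
    (i' := d' ≫ (hp'.isoIsPullback _ _ hp).hom) (by simp) (by simp)⟩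

theorem IsDeflation.of_isPullback {A M B N : C} {p' : N ⟶ M} {j' : N ⟶ B} {j : M ⟶ A} {p : B ⟶ A}
    (hp : IsPullback p' j' j p) (hj : E.IsDeflation j) : E.IsDeflation j' := by
  obtain ⟨Z, d, w, h⟩ := hj
  obtain ⟨k, hk⟩ := Conf.exists_kernel_of_isPullback hp ⟨w, h⟩
  exact hk.isDeflation

/-- The map factors as the graph of `f` followed by `u ⊕ 1`. The graph is a pushout of `0 ↣ Z`, the
kernel of the identity of `Z`, and `u ⊕ 1` is a pushout of `u`. -/
theorem IsInflation.biprod_lift {X Y Z : C} {u : X ⟶ Y} (hu : E.IsInflation u) (f : X ⟶ Z) :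
    E.IsInflation (biprod.lift u f) := by
  obtain ⟨O, i, w, h⟩ := E.id_deflation Z
  have h : E.Conf i (𝟙 Z) := ⟨w, h⟩
  have hi : i = 0 := by simpa using w
  have hz : IsZero O := (IsZero.iff_id_eq_zero O).2 (by
    have := h.mono
    rw [← cancel_mono i, hi]; simp)
  have h₁ : IsPushout i (0 : O ⟶ X) biprod.inr (biprod.lift (𝟙 X) f) :=
    IsPushout.mk' (hz.eq_of_src _ _) (fun T a b h1 h2 => by
        have h3 : biprod.inl = biprod.lift (𝟙 X) f - f ≫ biprod.inr := by ext <;> simp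
        ext
        · simp [h3, Preadditive.sub_comp, h1, h2]
        · exact h1)
      fun T a b _ => ⟨biprod.desc (b - f ≫ a) a, by simp, by simp [biprod.lift_desc]⟩
  have h₂ : IsPushout u biprod.inl biprod.inl (biprod.map u (𝟙 Z)) :=
    IsPushout.mk' (by simp) (fun T a b h1 h2 => by
        ext
        · exact h1
        · simpa using biprod.inr ≫= h2)
      fun T a b e => ⟨biprod.desc a (biprod.inr ≫ b), by simp, by ext <;> simp [e]⟩
  have e : biprod.lift u f = biprod.lift (𝟙 X) f ≫ biprod.map u (𝟙 Z) := by ext <;> simp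
  rw [e]
  exact E.comp_inflation _ _ (h.isInflation.of_isPushout h₁) (hu.of_isPushout h₂)

theorem IsDeflation.biprod_desc {X Y Z : C} {u : Y ⟶ X} (hu : E.IsDeflation u) (f : Z ⟶ X) :
    E.IsDeflation (biprod.desc u f) := by
  obtain ⟨O, i, w, h⟩ := E.id_inflation Z
  have h : E.Conf (𝟙 Z) i := ⟨w, h⟩
  have hi : i = 0 := by simpa using w
  have hz : IsZero O := (IsZero.iff_id_eq_zero O).2 (by
    have := h.epi
    rw [← cancel_epi i, hi]; simp)
  have h₁ : IsPullback biprod.snd (biprod.desc (𝟙 X) f) i (0 : X ⟶ O) :=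
    IsPullback.mk' (hz.eq_of_tgt _ _) (fun T a b h1 h2 => by
        have h3 : biprod.fst = biprod.desc (𝟙 X) f - biprod.snd ≫ f := by ext <;> simp
        ext
        · rw [h3, Preadditive.comp_sub, Preadditive.comp_sub, h2, reassoc_of% h1]
        · exact h1)
      fun T a b _ => ⟨biprod.lift (b - a ≫ f) a, by simp, by simp [biprod.lift_desc]⟩
  have h₂ : IsPullback biprod.fst (biprod.map u (𝟙 Z)) u biprod.fst :=
    IsPullback.mk' (by simp) (fun T a b h1 h2 => by
        ext
        · exact h1
        · simpa using h2 =≫ biprod.snd)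
      fun T a b e => ⟨biprod.lift a (b ≫ biprod.snd), by simp, by ext <;> simp [e]⟩
  have e : biprod.desc u f = biprod.map u (𝟙 Z) ≫ biprod.desc (𝟙 X) f := by ext <;> simp
  rw [e]
  exact E.comp_deflation _ _ (hu.of_isPullback h₂) (h.isDeflation.of_isPullback h₁)

/-- A pushout square along an inflation gives a short exact sequence. -/
theorem Conf.of_isPushout_biprod {X Y X' Y' : C} {u : X ⟶ Y} {f : X ⟶ X'} {f' : Y ⟶ Y'}
    {u' : X' ⟶ Y'} (hp : IsPushout u f f' u') (hu : E.IsInflation u) :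
    E.Conf (biprod.lift u (-f)) (biprod.desc f' u') := by
  refine Conf.of_cokernel (hu.biprod_lift _) ?_ ⟨fun a b h => hp.hom_ext ?_ ?_⟩ fun g hg => ?_
  · simp [biprod.lift_desc, hp.w]
  · simpa using biprod.inl ≫= h
  · simpa using biprod.inr ≫= h
  · have e : u ≫ biprod.inl ≫ g = f ≫ biprod.inr ≫ g := by
      rw [biprod.lift_eq] at hg
      simpa [Preadditive.add_comp, ← sub_eq_add_neg, sub_eq_zero] using hg
    exact ⟨hp.desc _ _ e, by ext <;> simp⟩

end ExactStructure
end
end TwinCotorsion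

/-! ### Cotorsion pairs, and the class `H` when `U ⊆ T`. -/

namespace TwinCotorsion

section

variable {C : Type u} [Category.{v} C] [Preadditive C] [HasFiniteBiproducts C]

theorem IsAdditiveSubcategory.of_iso {P : ObjectProperty C} (hP : IsAdditiveSubcategory P)
    {X Y : C} (e : X ≅ Y) (hX : P X) : P Y := by
  obtain ⟨Z, hZ, -⟩ := hP.zero
  have hz : (biprod.snd : Y ⊞ Z ⟶ Z) = 0 := hZ.eq_of_tgt _ _
  refine hP.summand Y Z X ⟨e ≪≫ ⟨biprod.inl, biprod.fst, by simp, ?_⟩⟩ hX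
  ext
  · simp
  · simp [hz]
  · exact hZ.eq_of_src _ _
  · exact hZ.eq_of_src _ _

namespace CotorsionPair

variable {E : ExactStructure C} (P : CotorsionPair E)

/-- The approximation `V ↣ U ↠ X` splits, so `X` is a summand of `U`. -/
theorem left_of_extVanishes {X : C} (h : ∀ V, P.right V → E.ExtVanishes X V) : P.left X := by
  obtain ⟨V, U, hV, hU, i, d, hc⟩ := P.exists_deflation X
  have hc : E.Conf i d := hc
  obtain ⟨s, hs⟩ := hc.exists_lifting (h V hV) (𝟙 X)
  obtain ⟨e⟩ := hc.iso_biprod (hc.splitting_of_section s hs)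
  exact P.additive_left.summand X V U ⟨e ≪≫ biprod.braiding _ _⟩ hU

theorem right_of_extVanishes {X : C} (h : ∀ U, P.left U → E.ExtVanishes U X) : P.right X := by
  obtain ⟨V, U, hV, hU, i, d, hc⟩ := P.exists_inflation X
  have hc : E.Conf i d := hc
  obtain ⟨s, hs⟩ := hc.exists_extension (h U hU) (𝟙 X)
  obtain ⟨e⟩ := hc.iso_biprod (hc.splitting_of_retraction s hs)
  exact P.additive_right.summand X U V ⟨e⟩ hV

theorem left_of_isProjective {X : C} (hX : E.IsProjective X) : P.left X :=
  P.left_of_extVanishes fun _ _ => ExactStructure.extVanishes_of_lifting fun hc =>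
    hX _ hc.isDeflation (𝟙 X)

theorem right_of_extension {Y V V' : C} {k : V ⟶ Y} {p : Y ⟶ V'} (h : E.Conf k p)
    (hV : P.right V) (hV' : P.right V') : P.right Y :=
  P.right_of_extVanishes fun U hU => ExactStructure.extVanishes_of_lifting fun {M i d} hc => by
    -- A section over `U` is built in two stages: first into the pushout `N`, an extension of `U` by
    -- `V'`, then along `M ↠ N`, whose kernel is `V`.
    obtain ⟨N, p', i', d', hp, hc', hd⟩ := hc.exists_pushout p
    obtain ⟨s, hs⟩ := hc'.exists_lifting (P.ext_vanishes _ _ hU hV') (𝟙 U)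
    obtain ⟨s', hs'⟩ := (ExactStructure.Conf.of_isPushout hp h hc.isInflation).exists_lifting
      (P.ext_vanishes _ _ hU hV) s
    exact ⟨s', by rw [← hd, reassoc_of% hs', hs]⟩

/-- The kernel of a composition of two deflations whose kernels are in the right class of a
cotorsion pair is in the right class. -/
theorem exists_conf_comp {K L M V V' : C} {p : L ⟶ K} {p' : K ⟶ M} {k : V ⟶ L} {k' : V' ⟶ K}
    (h : E.Conf k p) (h' : E.Conf k' p') (hV : P.right V) (hV' : P.right V') :
    ∃ (W : C) (j : W ⟶ L), P.right W ∧ E.Conf j (p ≫ p') := by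
  obtain ⟨W, j, d, i, hp, hc, -⟩ := h.exists_pullback k'
  exact ⟨W, j, P.right_of_extension hc hV hV',
    ExactStructure.Conf.of_isPullback hp h' h.isDeflation⟩

theorem left_of_split {X Y Z : C} {i : X ⟶ Y} {d : Y ⟶ Z} (h : E.Conf i d)
    (hX : P.left X) (hZ : P.left Z) (hs : E.ExtVanishes Z X) : P.left Y := by
  obtain ⟨e⟩ := h.iso_biprod (hs _ _ _ h.1 h.2)
  exact P.additive_left.of_iso e.symm (P.additive_left.biprod _ _ hX hZ)

end CotorsionPair

namespace TwinCotorsionPair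

variable {E : ExactStructure C} {D : TwinCotorsionPair E}

theorem W_iff (hD : D.U ≤ D.T) {X : C} : D.W X ↔ D.U X :=
  ⟨fun h => h.2, fun h => ⟨hD _ h, h⟩⟩

theorem H_iff (hD : D.U ≤ D.T) {X : C} :
    D.H X ↔ ∃ (U S : C) (u : X ⟶ U) (s : U ⟶ S), D.U U ∧ D.S S ∧ E.Conf u s := by
  constructor
  · rintro ⟨-, U, S, hU, hS, u, s, h⟩
    exact ⟨U, S, u, s, hU.2, hS, h⟩
  · rintro ⟨U, S, u, s, hU, hS, h⟩
    obtain ⟨V, U', hV, hU', h'⟩ := D.snd.exists_deflation X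
    exact ⟨⟨V, U', hV, (W_iff hD).2 hU', h'⟩, U, S, (W_iff hD).2 hU, hS, u, s, h⟩

theorem ext_vanishes_S_U (hD : D.U ≤ D.T) {S U : C} (hS : D.S S) (hU : D.U U) :
    E.ExtVanishes S U := D.fst.ext_vanishes _ _ hS (hD _ hU)

theorem ext_vanishes_S_V {S V : C} (hS : D.S S) (hV : D.V V) :
    E.ExtVanishes S V := D.snd.ext_vanishes _ _ (D.le _ hS) hV

/-- The approximation `X ↣ T ↠ S` splits, so its middle term is again in `U`. -/
theorem H_of_U (hD : D.U ≤ D.T) {X : C} (hX : D.U X) : D.H X := by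
  obtain ⟨T, S, hT, hS, i, d, h⟩ := D.fst.exists_inflation X
  exact (H_iff hD).2 ⟨T, S, i, d, D.snd.left_of_split h hX (D.le _ hS)
    (ext_vanishes_S_U hD hS hX), hS, h⟩

theorem H_biprod (hD : D.U ≤ D.T) {X Y : C} (hX : D.H X) (hY : D.H Y) : D.H (X ⊞ Y) := by
  obtain ⟨U, S, u, s, hU, hS, h⟩ := (H_iff hD).1 hX
  obtain ⟨U', S', u', s', hU', hS', h'⟩ := (H_iff hD).1 hY
  exact (H_iff hD).2 ⟨_, _, _, _, D.snd.additive_left.biprod _ _ hU hU',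
    D.fst.additive_left.biprod _ _ hS hS', _, E.directSum _ _ h.2 h'.2⟩

theorem H_of_inflation (hD : D.U ≤ D.T) {X Y S : C} {i : X ⟶ Y} {d : Y ⟶ S} (h : E.Conf i d)
    (hX : D.H X) (hS : D.S S) : D.H Y := by
  obtain ⟨U, S', u, s, hU, hS', h'⟩ := (H_iff hD).1 hX
  -- The pushout `N` of `U` and `Y` under `X` lies in two conflations: `U ↣ N ↠ S` splits and puts
  -- `N` in `U`, while `Y ↣ N ↠ S'` exhibits `Y` in `H`.
  obtain ⟨N, u', i', s'', hp, hc, -⟩ := h'.exists_pushout i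
  obtain ⟨N', i'', j, d', hp', hc', -⟩ := h.exists_pushout u
  have hc'' := hc'.of_isos (Iso.refl _) (hp'.isoIsPushout _ _ hp.flip) (Iso.refl _)
    (i' := u') (d' := (hp'.isoIsPushout _ _ hp.flip).inv ≫ d') (by simp) (by simp)
  exact (H_iff hD).2 ⟨N, S', i', s'', D.snd.left_of_split hc'' hU (D.le _ hS)
    (ext_vanishes_S_U hD hS hU), hS', hc⟩

theorem H_of_kernel (hD : D.U ≤ D.T) {X Y S : C} {i : X ⟶ Y} {d : Y ⟶ S} (h : E.Conf i d)
    (hY : D.H Y) (hS : D.S S) : D.H X := by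
  obtain ⟨U, S', u, s, hU, hS', h'⟩ := (H_iff hD).1 hY
  -- The composite `X ↣ Y ↣ U` has cokernel `N`, an extension of `S'` by `S`; it splits because `S ⊆
  -- U ⊆ T`.
  obtain ⟨N, u', i', s'', hp, hc, -⟩ := h'.exists_pushout d
  exact (H_iff hD).2 ⟨U, N, _, _, hU, D.fst.left_of_split hc hS hS'
    (ext_vanishes_S_U hD hS' (D.le _ hS)),
    ExactStructure.Conf.of_isPushout hp h h'.isInflation⟩

/-- Every object `X` receives a deflation with kernel in `V` from an object of `H`, such that all
morphisms from `H` to `X` lift. -/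
theorem exists_coreflection (hD : D.U ≤ D.T) (X : C) :
    ∃ (L V : C) (k : V ⟶ L) (p : L ⟶ X), D.H L ∧ D.V V ∧ E.Conf k p ∧
      ∀ {Y : C} (_ : D.H Y) (f : Y ⟶ X), ∃ g : Y ⟶ L, g ≫ p = f := by
  obtain ⟨T, S, hT, hS, i, d, h⟩ := D.fst.exists_inflation X
  obtain ⟨V, U, hV, hU, k, e, h'⟩ := D.snd.exists_deflation T
  have h : E.Conf i d := h
  have h' : E.Conf k e := h'
  obtain ⟨L, l, p, k', hp, hc, -⟩ := h'.exists_pullback i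
  refine ⟨L, V, k', p, (H_iff hD).2 ⟨U, S, _, _, hU, hS,
    ExactStructure.Conf.of_isPullback hp h h'.isDeflation⟩, hV, hc, fun {Y} hY f => ?_⟩
  -- The map `Y ⟶ X ⟶ T` extends to `U'` as `Ext¹(S', T) = 0`, then lifts to `U` as `Ext¹(U', V) =
  -- 0`; with `f` this defines a map to the pullback.
  obtain ⟨U', S', u, s, hU', hS', h''⟩ := (H_iff hD).1 hY
  obtain ⟨a, ha⟩ := h''.exists_extension (D.fst.ext_vanishes _ _ hS' hT) (f ≫ i)
  obtain ⟨b, hb⟩ := h'.exists_lifting (D.snd.ext_vanishes _ _ hU' hV) a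
  exact ⟨hp.lift (u ≫ b) f (by rw [Category.assoc, hb, ha]), hp.lift_snd _ _ _⟩

end TwinCotorsionPair
end
end TwinCotorsion

/-! ### Kernels, cokernels, normal monomorphisms and normal epimorphisms in the heart. -/

namespace TwinCotorsion

section

variable {C : Type u} [Category.{v} C] [Preadditive C] [HasFiniteBiproducts C]
  {E : ExactStructure C} {A : Type u} [Category.{v} A]

namespace TwinCotorsionPair

variable {D : TwinCotorsionPair E}

/-- The action of a functor on `H` on a morphism between objects of `H`. -/
def hMap (q : D.H.FullSubcategory ⥤ A) {X Y : C} (hX : D.H X) (hY : D.H Y) (f : X ⟶ Y) :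
    q.obj ⟨X, hX⟩ ⟶ q.obj ⟨Y, hY⟩ :=
  q.map (ObjectProperty.homMk f)

section

variable (q : D.H.FullSubcategory ⥤ A) {X Y Z : C} (hX : D.H X) (hY : D.H Y) (hZ : D.H Z)

theorem hMap_comp (f : X ⟶ Y) (g : Y ⟶ Z) : hMap q hX hZ (f ≫ g) =
    hMap q hX hY f ≫ hMap q hY hZ g :=
  q.map_comp (X := ⟨X, hX⟩) (Y := ⟨Y, hY⟩) (Z := ⟨Z, hZ⟩) (ObjectProperty.homMk f)
    (ObjectProperty.homMk g)

theorem hMap_id : hMap q hX hX (𝟙 X) = 𝟙 (q.obj ⟨X, hX⟩) := q.map_id _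

end

variable [Preadditive A]

/-- A functor on `H` which exhibits its target as the quotient by the morphisms factoring through
an object of `W`. -/
structure IsHeartFunctor (q : D.H.FullSubcategory ⥤ A) : Prop where
  map_add : ∀ {X Y : D.H.FullSubcategory} (f g : X ⟶ Y), q.map (f + g) = q.map f + q.map g
  map_surjective : ∀ X Y : D.H.FullSubcategory,
    Function.Surjective (q.map : (X ⟶ Y) → (q.obj X ⟶ q.obj Y))
  obj_surjective : Function.Surjective q.obj
  map_eq_zero_iff : ∀ {X Y : D.H.FullSubcategory} (f : X ⟶ Y),
    q.map f = 0 ↔ ∃ (Z : C) (a : X.obj ⟶ Z) (b : Z ⟶ Y.obj), D.W Z ∧ a ≫ b = f.hom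

namespace IsHeartFunctor

variable {q : D.H.FullSubcategory ⥤ A}

section

variable (hq : IsHeartFunctor q) {X Y Z : C} (hX : D.H X) (hY : D.H Y) (hZ : D.H Z)

include hq

theorem hMap_add (f g : X ⟶ Y) : hMap q hX hY (f + g) = hMap q hX hY f + hMap q hX hY g :=
  hq.map_add (X := ⟨X, hX⟩) (Y := ⟨Y, hY⟩) (ObjectProperty.homMk f) (ObjectProperty.homMk g)

theorem hMap_zero : hMap q hX hY (0 : X ⟶ Y) = 0 := by
  simpa using hq.hMap_add hX hY 0 0

theorem hMap_neg (f : X ⟶ Y) : hMap q hX hY (-f) = -hMap q hX hY f := by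
  rw [eq_neg_iff_add_eq_zero, ← hq.hMap_add, neg_add_cancel, hq.hMap_zero]

theorem hMap_sub (f g : X ⟶ Y) : hMap q hX hY (f - g) = hMap q hX hY f - hMap q hX hY g := by
  rw [sub_eq_add_neg, sub_eq_add_neg, hq.hMap_add, hq.hMap_neg]

theorem hMap_surjective : Function.Surjective (hMap q hX hY) := fun f => by
  obtain ⟨g, rfl⟩ := hq.map_surjective _ _ f
  exact ⟨g.hom, rfl⟩

theorem hMap_eq_zero_iff (hD : D.U ≤ D.T) {f : X ⟶ Y} :
    hMap q hX hY f = 0 ↔ ∃ (U : C) (a : X ⟶ U) (b : U ⟶ Y), D.U U ∧ a ≫ b = f := by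
  refine (hq.map_eq_zero_iff _).trans ?_
  simp only [W_iff hD]
  rfl

theorem hMap_eq_iff (hD : D.U ≤ D.T) {f g : X ⟶ Y} :
    hMap q hX hY f = hMap q hX hY g ↔
      ∃ (U : C) (a : X ⟶ U) (b : U ⟶ Y), D.U U ∧ a ≫ b = f - g := by
  rw [← hq.hMap_eq_zero_iff hX hY hD, hq.hMap_sub, sub_eq_zero]

theorem exists_obj (Z : A) : ∃ (X : C) (hX : D.H X), q.obj ⟨X, hX⟩ = Z := by
  obtain ⟨⟨X, hX⟩, h⟩ := hq.obj_surjective Z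
  exact ⟨X, hX, h⟩

end

section

variable (hq : IsHeartFunctor q) (hD : D.U ≤ D.T)

include hq hD

/-- If `i ≫ g` factors through `U`, extend its first factor along `i`. The corrected `g` vanishes on
`X`, so it factors through `S`, and `g` itself factors through `U ⊞ S`. -/
theorem epi_hMap {X Y S : C} (hX : D.H X) (hY : D.H Y) {i : X ⟶ Y} {d : Y ⟶ S} (h : E.Conf i d)
    (hS : D.S S) : Epi (hMap q hX hY i) := by
  refine Preadditive.epi_of_cancel_zero _ fun {P} g hg => ?_
  obtain ⟨W, hW, rfl⟩ := hq.exists_obj P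
  obtain ⟨g, rfl⟩ := hq.hMap_surjective _ _ g
  rw [← hMap_comp, hq.hMap_eq_zero_iff _ _ hD] at hg
  obtain ⟨U, a, b, hU, hab⟩ := hg
  obtain ⟨c, hc⟩ := h.exists_extension (ext_vanishes_S_U hD hS hU) a
  obtain ⟨l, hl⟩ := h.desc (g - c ≫ b) (by
    rw [Preadditive.comp_sub, reassoc_of% hc, hab, sub_self])
  rw [hq.hMap_eq_zero_iff _ _ hD]
  refine ⟨U ⊞ S, biprod.lift c d, biprod.desc b l,
    D.snd.additive_left.biprod _ _ hU (D.le _ hS), ?_⟩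
  rw [biprod.lift_desc, hl]
  abel

theorem mono_hMap {X Y V : C} (hX : D.H X) (hY : D.H Y) {k : V ⟶ X} {p : X ⟶ Y} (h : E.Conf k p)
    (hV : D.V V) : Mono (hMap q hX hY p) := by
  refine Preadditive.mono_of_cancel_zero _ fun {P} g hg => ?_
  obtain ⟨W, hW, rfl⟩ := hq.exists_obj P
  obtain ⟨g, rfl⟩ := hq.hMap_surjective _ _ g
  rw [← hMap_comp, hq.hMap_eq_zero_iff _ _ hD] at hg
  obtain ⟨U, a, b, hU, hab⟩ := hg
  obtain ⟨c, hc⟩ := h.exists_lifting (D.snd.ext_vanishes _ _ hU hV) b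
  obtain ⟨l, hl⟩ := h.lift (g - a ≫ c) (by
    rw [Preadditive.sub_comp, Category.assoc, hc, hab, sub_self])
  -- The corrected `g` lands in `V`. Since `W ∈ H` and `Ext¹(S', V) = 0`, a map from `W` to `V`
  -- factors through `U'`.
  obtain ⟨U', S', u, s, hU', hS', h'⟩ := (H_iff hD).1 hW
  obtain ⟨m, hm⟩ := h'.exists_extension (ext_vanishes_S_V hS' hV) l
  rw [hq.hMap_eq_zero_iff _ _ hD]
  refine ⟨U ⊞ U', biprod.lift a u, biprod.desc c (m ≫ k),
    D.snd.additive_left.biprod _ _ hU hU', ?_⟩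
  rw [biprod.lift_desc, reassoc_of% hm, hl]
  abel

/-- Cokernels in the heart are computed by pushouts. -/
theorem exists_desc_of_isPushout {X Y Z U S : C} (hX : D.H X) (hY : D.H Y) (hZ : D.H Z)
    {u : X ⟶ U} {s : U ⟶ S} {f : X ⟶ Y} {a : U ⟶ Z} {b : Y ⟶ Z} (h : E.Conf u s)
    (hS : D.S S) (hp : IsPushout u f a b) {P : A} (g : q.obj ⟨Y, hY⟩ ⟶ P)
    (hg : hMap q hX hY f ≫ g = 0) : ∃ l, hMap q hY hZ b ≫ l = g := by
  obtain ⟨W, hW, rfl⟩ := hq.exists_obj P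
  obtain ⟨g, rfl⟩ := hq.hMap_surjective _ _ g
  rw [← hMap_comp, hq.hMap_eq_zero_iff _ _ hD] at hg
  obtain ⟨U', c, d, hU', hcd⟩ := hg
  obtain ⟨e, he⟩ := h.exists_extension (ext_vanishes_S_U hD hS hU') c
  refine ⟨hMap q hZ hW (hp.desc (e ≫ d) g (by rw [reassoc_of% he, hcd])), ?_⟩
  rw [← hMap_comp, hp.inr_desc]

/-- Kernels in the heart are computed by pullbacks. -/
theorem exists_lift_of_isPullback {X Y L K U V : C} (hX : D.H X) (hY : D.H Y) (hL : D.H L)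
    {k : V ⟶ U} {e : U ⟶ Y} {f : X ⟶ Y} {a : K ⟶ U} {b : K ⟶ X} (h : E.Conf k e) (hV : D.V V)
    (hp : IsPullback a b e f) {p : L ⟶ K}
    (hlift : ∀ {W : C} (_ : D.H W) (g : W ⟶ K), ∃ l : W ⟶ L, l ≫ p = g)
    {P : A} (g : P ⟶ q.obj ⟨X, hX⟩)
    (hg : g ≫ hMap q hX hY f = 0) : ∃ l, l ≫ hMap q hL hX (p ≫ b) = g := by
  obtain ⟨W, hW, rfl⟩ := hq.exists_obj P
  obtain ⟨g, rfl⟩ := hq.hMap_surjective _ _ g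
  rw [← hMap_comp, hq.hMap_eq_zero_iff _ _ hD] at hg
  obtain ⟨U', c, d, hU', hcd⟩ := hg
  obtain ⟨m, hm⟩ := h.exists_lifting (D.snd.ext_vanishes _ _ hU' hV) d
  obtain ⟨l, hl⟩ := hlift hW (hp.lift (c ≫ m) g (by rw [Category.assoc, hm, hcd]))
  refine ⟨hMap q hW hL l, ?_⟩
  rw [← hMap_comp, reassoc_of% hl, hp.lift_snd]

theorem hMap_comp_eq_zero {X Y Z U : C} (hX : D.H X) (hY : D.H Y) (hZ : D.H Z) (hU : D.U U)
    {f : X ⟶ Y} {g : Y ⟶ Z} (a : X ⟶ U) (b : U ⟶ Z) (h : a ≫ b = f ≫ g) :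
    hMap q hX hY f ≫ hMap q hY hZ g = 0 := by
  rw [← hMap_comp, hq.hMap_eq_zero_iff _ _ hD]
  exact ⟨U, a, b, hU, h⟩

theorem exists_cokernel {X Y : C} (hX : D.H X) (hY : D.H Y) (f : X ⟶ Y) :
    ∃ (Z S : C) (hZ : D.H Z) (i : Y ⟶ Z) (d : Z ⟶ S) (w : hMap q hX hY f ≫ hMap q hY hZ i = 0),
      D.S S ∧ E.Conf i d ∧ Nonempty (IsColimit (CokernelCofork.ofπ _ w)) := by
  obtain ⟨U, S, u, s, hU, hS, h⟩ := (H_iff hD).1 hX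
  obtain ⟨Z, f', i, d, hp, hc, -⟩ := h.exists_pushout f
  have hZ := H_of_inflation hD hc hY hS
  have := hq.epi_hMap hD hY hZ hc hS
  refine ⟨Z, S, hZ, i, d, hq.hMap_comp_eq_zero hD _ _ _ hU u f' hp.w, hS, hc, ⟨?_⟩⟩
  refine CokernelCofork.IsColimit.ofπ' _ _ fun g hg =>
    ⟨_, (hq.exists_desc_of_isPushout hD hX hY hZ h hS hp g hg).choose_spec⟩

theorem exists_kernel {X Y : C} (hX : D.H X) (hY : D.H Y) (f : X ⟶ Y) :
    ∃ (Z V : C) (hZ : D.H Z) (k : V ⟶ Z) (p : Z ⟶ X) (w : hMap q hZ hX p ≫ hMap q hX hY f = 0),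
      D.V V ∧ E.Conf k p ∧ Nonempty (IsLimit (KernelFork.ofι _ w)) := by
  obtain ⟨V, U, hV, hU, k, e, h⟩ := D.snd.exists_deflation Y
  have h : E.Conf k e := h
  obtain ⟨K, a, b, k', hp, hc, -⟩ := h.exists_pullback f
  -- The pullback `K` need not be in `H`; its coreflection is used instead, and the total kernel
  -- stays in `V` by extension closure.
  obtain ⟨L, V', k'', p, hL, hV', hc', hlift⟩ := exists_coreflection hD K
  obtain ⟨V'', j, hV'', hj⟩ := D.snd.exists_conf_comp hc' hc hV' hV
  have := hq.mono_hMap hD hL hX hj hV''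
  refine ⟨L, V'', hL, j, p ≫ b, hq.hMap_comp_eq_zero hD _ _ _ hU (p ≫ a) e (by simp [hp.w]),
    hV'', hj, ⟨?_⟩⟩
  refine KernelFork.IsLimit.ofι' _ _ fun g hg =>
    ⟨_, (hq.exists_lift_of_isPullback hD hX hY hL h hV hp hlift g hg).choose_spec⟩

theorem exists_conf_of_normalEpi {X : C} (hX : D.H X) {Z : A} (δ : q.obj ⟨X, hX⟩ ⟶ Z)
    (hδ : NormalEpi δ) : ∃ (Y S : C) (hY : D.H Y) (i : X ⟶ Y) (d : Y ⟶ S)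
      (e : q.obj ⟨Y, hY⟩ ≅ Z), D.S S ∧ E.Conf i d ∧ hMap q hX hY i ≫ e.hom = δ := by
  obtain ⟨W, g, w, hl⟩ := hδ
  obtain ⟨W, hW, rfl⟩ := hq.exists_obj W
  obtain ⟨g, rfl⟩ := hq.hMap_surjective _ _ g
  obtain ⟨Y, S, hY, i, d, w', hS, hc, ⟨hl'⟩⟩ := hq.exists_cokernel hD hW hX g
  exact ⟨Y, S, hY, i, d, hl'.coconePointUniqueUpToIso hl, hS, hc,
    hl'.comp_coconePointUniqueUpToIso_hom hl WalkingParallelPair.one⟩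

theorem exists_conf_of_normalMono {X : C} (hX : D.H X) {Z : A} (δ : Z ⟶ q.obj ⟨X, hX⟩)
    (hδ : NormalMono δ) : ∃ (Y V : C) (hY : D.H Y) (k : V ⟶ Y) (p : Y ⟶ X)
      (e : Z ≅ q.obj ⟨Y, hY⟩), D.V V ∧ E.Conf k p ∧ e.hom ≫ hMap q hY hX p = δ := by
  obtain ⟨W, g, w, hl⟩ := hδ
  obtain ⟨W, hW, rfl⟩ := hq.exists_obj W
  obtain ⟨g, rfl⟩ := hq.hMap_surjective _ _ g
  obtain ⟨Y, V, hY, k, p, w', hV, hc, ⟨hl'⟩⟩ := hq.exists_kernel hD hX hW g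
  exact ⟨Y, V, hY, k, p, hl.conePointUniqueUpToIso hl', hV, hc,
    hl.conePointUniqueUpToIso_hom_comp hl' WalkingParallelPair.zero⟩

/-- Pushing out `p` along `X ↣ U` gives `b : Y ↣ Z`, and `p` becomes the kernel of `b`. A
factorization of `g ≫ b` through `U'` lifts along the deflation `U ↠ Z`, whose kernel is `V`, and
the lift restricts to `X`. -/
theorem normalMono_hMap {X Y V : C} (hX : D.H X) (hY : D.H Y) {k : V ⟶ X} {p : X ⟶ Y}
    (h : E.Conf k p) (hV : D.V V) : Nonempty (NormalMono (hMap q hX hY p)) := by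
  obtain ⟨U, S, u, s, hU, hS, h'⟩ := (H_iff hD).1 hX
  obtain ⟨Z, a, b, d, hp, hc, hd⟩ := h'.exists_pushout p
  have hZ := H_of_inflation hD hc hY hS
  have ha := ExactStructure.Conf.of_isPushout hp h h'.isInflation
  have := hq.mono_hMap hD hX hY h hV
  have := hc.mono
  refine ⟨⟨_, hMap q hY hZ b, hq.hMap_comp_eq_zero hD _ _ _ hU u a hp.w, ?_⟩⟩
  refine KernelFork.IsLimit.ofι' _ _ fun {P} g hg => ⟨_, Exists.choose_spec (?_ : ∃ l, l ≫ _ = g)⟩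
  obtain ⟨W, hW, rfl⟩ := hq.exists_obj P
  obtain ⟨g, rfl⟩ := hq.hMap_surjective _ _ g
  rw [← hMap_comp, hq.hMap_eq_zero_iff _ _ hD] at hg
  obtain ⟨U', x, y, hU', hxy⟩ := hg
  obtain ⟨m, hm⟩ := ha.exists_lifting (D.snd.ext_vanishes _ _ hU' hV) y
  obtain ⟨l, hl⟩ := h'.lift (x ≫ m) (by
    rw [← hd, Category.assoc, reassoc_of% hm, reassoc_of% hxy, hc.w, comp_zero])
  refine ⟨hMap q hW hX l, ?_⟩
  rw [← hMap_comp]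
  congr 1
  rw [← cancel_mono b, Category.assoc, ← hp.w, reassoc_of% hl, hm, hxy]

/-- Pulling back a deflation `U ↠ Y` along `i` gives `b : Z ↠ X`, whose cokernel in the heart is
`i`. Here `Z ∈ H` because `Z ↣ U` has cokernel `S`. -/
theorem normalEpi_hMap {X Y S : C} (hX : D.H X) (hY : D.H Y) {i : X ⟶ Y} {d : Y ⟶ S}
    (h : E.Conf i d) (hS : D.S S) : Nonempty (NormalEpi (hMap q hX hY i)) := by
  obtain ⟨V, U, hV, hU, k, e, h'⟩ := D.snd.exists_deflation Y
  have h' : E.Conf k e := h'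
  obtain ⟨Z, a, b, k', hp, hc, hk⟩ := h'.exists_pullback i
  have ha := ExactStructure.Conf.of_isPullback hp h h'.isDeflation
  have hZ := H_of_kernel hD ha (H_of_U hD hU) hS
  have := hq.epi_hMap hD hX hY h hS
  have := hc.epi
  refine ⟨⟨_, hMap q hZ hX b, hq.hMap_comp_eq_zero hD _ _ _ hU a e hp.w, ?_⟩⟩
  refine CokernelCofork.IsColimit.ofπ' _ _ fun {P} g hg =>
    ⟨_, Exists.choose_spec (?_ : ∃ l, _ ≫ l = g)⟩
  obtain ⟨W, hW, rfl⟩ := hq.exists_obj P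
  obtain ⟨g, rfl⟩ := hq.hMap_surjective _ _ g
  rw [← hMap_comp, hq.hMap_eq_zero_iff _ _ hD] at hg
  obtain ⟨U', x, y, hU', hxy⟩ := hg
  obtain ⟨m, hm⟩ := ha.exists_extension (ext_vanishes_S_U hD hS hU') x
  obtain ⟨l, hl⟩ := h'.desc (m ≫ y) (by
    rw [← hk, Category.assoc, reassoc_of% hm, hxy, reassoc_of% hc.w, zero_comp])
  refine ⟨hMap q hY hW l, ?_⟩
  rw [← hMap_comp]
  congr 1
  rw [← cancel_epi b, ← reassoc_of% hp.w, hl, reassoc_of% hm, hxy]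

end

end IsHeartFunctor

end TwinCotorsionPair
end
end TwinCotorsion

/-! ### The heart is preabelian and almost abelian. -/

namespace TwinCotorsion

section

theorem normalMono_of_arrow_iso {A : Type u} [Category.{v} A] [HasZeroMorphisms A] {X Y X' Y' : A}
    {f : X ⟶ Y} {f' : X' ⟶ Y'} (hf : Nonempty (NormalMono f)) (e₁ : X ≅ X') (e₂ : Y ≅ Y')
    (w : e₁.hom ≫ f' = f ≫ e₂.hom) : Nonempty (NormalMono f') :=
  hf.map fun h => NormalMono.ofArrowIso (hf := h) (Arrow.isoMk e₁ e₂ w)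

theorem normalEpi_of_arrow_iso {A : Type u} [Category.{v} A] [HasZeroMorphisms A] {X Y X' Y' : A}
    {f : X ⟶ Y} {f' : X' ⟶ Y'} (hf : Nonempty (NormalEpi f)) (e₁ : X ≅ X') (e₂ : Y ≅ Y')
    (w : e₁.hom ≫ f' = f ≫ e₂.hom) : Nonempty (NormalEpi f') :=
  hf.map fun h => NormalEpi.ofArrowIso (hf := h) (Arrow.isoMk e₁ e₂ w)

variable {C : Type u} [Category.{v} C] [Preadditive C] [HasFiniteBiproducts C]
  {E : ExactStructure C} {A : Type u} [Category.{v} A] [Preadditive A]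

namespace TwinCotorsionPair

variable {D : TwinCotorsionPair E}

namespace IsHeartFunctor

variable {q : D.H.FullSubcategory ⥤ A} (hq : IsHeartFunctor q)

include hq

theorem hMap_biprod_total {X Y : C} (hX : D.H X) (hY : D.H Y) (hXY : D.H (X ⊞ Y)) :
    hMap q hXY hX biprod.fst ≫ hMap q hX hXY biprod.inl +
      hMap q hXY hY biprod.snd ≫ hMap q hY hXY biprod.inr = 𝟙 _ := by
  rw [← hMap_comp, ← hMap_comp, ← hq.hMap_add, biprod.total, hMap_id]

variable (hD : D.U ≤ D.T)

include hD

theorem hasFiniteBiproducts : HasFiniteBiproducts A := by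
  have : HasBinaryBiproducts A := ⟨fun P Q => by
    obtain ⟨X, hX, rfl⟩ := hq.exists_obj P
    obtain ⟨Y, hY, rfl⟩ := hq.exists_obj Q
    have hXY := H_biprod hD hX hY
    refine hasBinaryBiproduct_of_total
      { pt := q.obj ⟨X ⊞ Y, hXY⟩
        fst := hMap q hXY hX biprod.fst
        snd := hMap q hXY hY biprod.snd
        inl := hMap q hX hXY biprod.inl
        inr := hMap q hY hXY biprod.inr
        inl_fst := ?_
        inl_snd := ?_
        inr_fst := ?_
        inr_snd := ?_ } ?_
    · rw [← hMap_comp, biprod.inl_fst, hMap_id]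
    · rw [← hMap_comp, biprod.inl_snd, hq.hMap_zero]
    · rw [← hMap_comp, biprod.inr_fst, hq.hMap_zero]
    · rw [← hMap_comp, biprod.inr_snd, hMap_id]
    · exact hq.hMap_biprod_total hX hY hXY⟩
  have : HasZeroObject A := by
    obtain ⟨Z, hZ, hU⟩ := D.snd.additive_left.zero
    have hH := H_of_U hD hU
    refine ⟨q.obj ⟨Z, hH⟩, (IsZero.iff_id_eq_zero _).2 ?_⟩
    rw [← hMap_id, hZ.eq_of_src (𝟙 Z) 0, hq.hMap_zero]
  have : HasFiniteProducts A := hasFiniteProducts_of_has_binary_and_terminal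
  exact HasFiniteBiproducts.of_hasFiniteProducts

theorem isPreabelian : IsPreabelian A where
  hasFiniteBiproducts := hq.hasFiniteBiproducts hD
  hasKernels := ⟨fun {P Q} f => by
    obtain ⟨X, hX, rfl⟩ := hq.exists_obj P
    obtain ⟨Y, hY, rfl⟩ := hq.exists_obj Q
    obtain ⟨f, rfl⟩ := hq.hMap_surjective _ _ f
    obtain ⟨_, _, _, _, _, _, _, _, ⟨h⟩⟩ := hq.exists_kernel hD hX hY f
    exact ⟨⟨_, h⟩⟩⟩
  hasCokernels := ⟨fun {P Q} f => by
    obtain ⟨X, hX, rfl⟩ := hq.exists_obj P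
    obtain ⟨Y, hY, rfl⟩ := hq.exists_obj Q
    obtain ⟨f, rfl⟩ := hq.hMap_surjective _ _ f
    obtain ⟨_, _, _, _, _, _, _, _, ⟨h⟩⟩ := hq.exists_cokernel hD hX hY f
    exact ⟨⟨_, h⟩⟩⟩

/-- Pushouts in the heart. -/
theorem isPushout_hMap {L X Y Z U S : C} (hL : D.H L) (hX : D.H X) (hY : D.H Y)
    (hZ : D.H Z) {u : L ⟶ U} {s : U ⟶ S} {f : L ⟶ X} {g : L ⟶ Y} {a : U ⟶ Z} {b : X ⊞ Y ⟶ Z}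
    (h : E.Conf u s) (hU : D.U U) (hS : D.S S) (hp : IsPushout u (biprod.lift (-f) g) a b) :
    IsPushout (hMap q hL hX f) (hMap q hL hY g) (hMap q hX hZ (biprod.inl ≫ b))
      (hMap q hY hZ (biprod.inr ≫ b)) := by
  have hXY := H_biprod hD hX hY
  -- The leg `b` is an inflation with cokernel `S`, hence epi in the heart; this gives uniqueness of
  -- maps out of `Z`.
  obtain ⟨b', s', hb⟩ : ∃ (b' : X ⊞ Y ⟶ Z) (s' : Z ⟶ S), b' = b ∧ E.Conf b' s' := by
    obtain ⟨Z', f', i', d', hp', h', -⟩ := h.exists_pushout (biprod.lift (-f) g)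
    exact ⟨b, (hp'.isoIsPushout _ _ hp).inv ≫ d', rfl, h'.of_isos (Iso.refl _)
      (hp'.isoIsPushout _ _ hp) (Iso.refl _) (by simp) (by simp)⟩
  obtain ⟨rfl, hb⟩ := hb
  have := hq.epi_hMap hD hXY hZ hb hS
  refine IsPushout.mk' ?_ (fun T φ φ' h₁ h₂ => ?_) fun T x y e => ?_
  · rw [← hMap_comp, ← hMap_comp, hq.hMap_eq_iff _ _ hD]
    refine ⟨U, -u, a, hU, ?_⟩
    rw [Preadditive.neg_comp, hp.w, biprod.lift_eq, Preadditive.add_comp]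
    simp [sub_eq_add_neg, add_comm]
  · rw [← cancel_epi (hMap q hXY hZ b'), ← Category.id_comp (hMap q hXY hZ b'),
      ← hq.hMap_biprod_total hX hY hXY]
    simp only [Preadditive.add_comp, Category.assoc]
    rw [← reassoc_of% hMap_comp q hX hXY hZ, ← reassoc_of% hMap_comp q hY hXY hZ, h₁, h₂,
      ← reassoc_of% hMap_comp q hX hXY hZ, ← reassoc_of% hMap_comp q hY hXY hZ]
  · obtain ⟨l, hl⟩ := hq.exists_desc_of_isPushout hD hL hXY hZ h hS hp
      (hMap q hXY hX biprod.fst ≫ x + hMap q hXY hY biprod.snd ≫ y) (by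
        rw [Preadditive.comp_add, ← reassoc_of% hMap_comp q hL hXY hX,
          ← reassoc_of% hMap_comp q hL hXY hY, biprod.lift_fst, biprod.lift_snd, hq.hMap_neg,
          Preadditive.neg_comp, e, neg_add_cancel])
    refine ⟨l, ?_, ?_⟩
    · rw [hMap_comp q hX hXY hZ, Category.assoc, hl, Preadditive.comp_add,
        ← reassoc_of% hMap_comp q hX hXY hX, ← reassoc_of% hMap_comp q hX hXY hY]
      simp [hq.hMap_zero, hMap_id]
    · rw [hMap_comp q hY hXY hZ, Category.assoc, hl, Preadditive.comp_add,
        ← reassoc_of% hMap_comp q hY hXY hX, ← reassoc_of% hMap_comp q hY hXY hY]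
      simp [hq.hMap_zero, hMap_id]

/-- Pullbacks in the heart. -/
theorem isPullback_hMap {K X Y Z U V : C} (hK : D.H K) (hX : D.H X) (hY : D.H Y)
    (hZ : D.H Z) {k : V ⟶ U} {e : U ⟶ Z} {f : X ⟶ Z} {g : Y ⟶ Z} {a : K ⟶ U} {b : K ⟶ X ⊞ Y}
    (h : E.Conf k e) (hU : D.U U) (hV : D.V V) (hp : IsPullback a b e (biprod.desc (-f) g)) :
    IsPullback (hMap q hK hX (b ≫ biprod.fst)) (hMap q hK hY (b ≫ biprod.snd))
      (hMap q hX hZ f) (hMap q hY hZ g) := by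
  have hXY := H_biprod hD hX hY
  obtain ⟨k', hb⟩ := ExactStructure.Conf.exists_kernel_of_isPullback hp h
  have := hq.mono_hMap hD hK hXY hb hV
  refine IsPullback.mk' ?_ (fun T φ φ' h₁ h₂ => ?_) fun T x y w => ?_
  · rw [← hMap_comp, ← hMap_comp, hq.hMap_eq_iff _ _ hD]
    refine ⟨U, -a, e, hU, ?_⟩
    rw [Preadditive.neg_comp, hp.w, biprod.desc_eq, Preadditive.comp_add]
    simp [sub_eq_add_neg, add_comm]
  · rw [← cancel_mono (hMap q hK hXY b), ← Category.comp_id (hMap q hK hXY b),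
      ← hq.hMap_biprod_total hX hY hXY]
    simp only [Preadditive.comp_add]
    simp only [← Category.assoc]
    simp only [Category.assoc _ (hMap q hK hXY b)]
    rw [← hMap_comp q hK hXY hX, ← hMap_comp q hK hXY hY, h₁, h₂]
  · obtain ⟨l, hl⟩ := hq.exists_lift_of_isPullback hD hXY hZ hK h hV hp (p := 𝟙 K)
      (fun _ g => ⟨g, Category.comp_id _⟩)
      (x ≫ hMap q hX hXY biprod.inl + y ≫ hMap q hY hXY biprod.inr) (by
        rw [Preadditive.add_comp, Category.assoc, Category.assoc, ← hMap_comp q hX hXY hZ,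
          ← hMap_comp q hY hXY hZ, biprod.inl_desc, biprod.inr_desc, hq.hMap_neg,
          Preadditive.comp_neg, w, neg_add_cancel])
    rw [Category.id_comp] at hl
    refine ⟨l, ?_, ?_⟩
    · rw [hMap_comp q hK hXY hX, ← Category.assoc, hl, Preadditive.add_comp, Category.assoc,
        Category.assoc, ← hMap_comp q hX hXY hX, ← hMap_comp q hY hXY hX]
      simp [hq.hMap_zero, hMap_id]
    · rw [hMap_comp q hK hXY hY, ← Category.assoc, hl, Preadditive.add_comp, Category.assoc,
        Category.assoc, ← hMap_comp q hX hXY hY, ← hMap_comp q hY hXY hY]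
      simp [hq.hMap_zero, hMap_id]

/-- The projection away from an object of `U` is invertible in the heart. -/
theorem exists_iso_biprod {X U : C} (hX : D.H X) (hU : D.U U) (hUX : D.H (U ⊞ X)) :
    ∃ e : q.obj ⟨X, hX⟩ ≅ q.obj ⟨U ⊞ X, hUX⟩, e.hom = hMap q hX hUX biprod.inr ∧
      e.inv = hMap q hUX hX biprod.snd := by
  refine ⟨⟨hMap q hX hUX biprod.inr, hMap q hUX hX biprod.snd, ?_, ?_⟩, rfl, rfl⟩
  · rw [← hMap_comp, biprod.inr_snd, hMap_id]
  · rw [← hMap_comp, ← hMap_id, hq.hMap_eq_iff _ _ hD]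
    refine ⟨U, -biprod.fst, biprod.inl, hU, ?_⟩
    rw [← biprod.total, Preadditive.neg_comp]
    abel

theorem normalMono_of_isPushout {X B Y Z : A} {α : B ⟶ X} {β : Y ⟶ X} {γ : Z ⟶ B} {δ : Z ⟶ Y}
    (hp : IsPushout γ δ α β) (hδ : Nonempty (NormalMono δ)) : Nonempty (NormalMono α) := by
  obtain ⟨hδ⟩ := hδ
  obtain ⟨Y, hY, rfl⟩ := hq.exists_obj Y
  obtain ⟨B, hB, rfl⟩ := hq.exists_obj B
  obtain ⟨L, V, hL, k, p, e, hV, h, rfl⟩ := hq.exists_conf_of_normalMono hD hY δ hδ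
  obtain ⟨g, hg⟩ := hq.hMap_surjective hL hB (e.inv ≫ γ)
  have hp₁ : IsPushout (hMap q hL hB g) (hMap q hL hY p) α β :=
    hp.of_iso e (Iso.refl _) (Iso.refl _) (Iso.refl _) (by simp [hg]) (by simp) (by simp) (by simp)
  obtain ⟨U, S, u, s, hU, hS, h'⟩ := (H_iff hD).1 hL
  obtain ⟨P, a, b, d, hpP, hc, -⟩ := h'.exists_pushout (biprod.lift (-g) p)
  have hP := H_of_inflation hD hc (H_biprod hD hB hY) hS
  have hp₂ := hq.isPushout_hMap hD hL hB hY hP h' hU hS hpP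
  have hw : u ≫ a = -(g ≫ biprod.inl ≫ b) + p ≫ biprod.inr ≫ b := by
    rw [hpP.w, biprod.lift_eq]; simp [Preadditive.add_comp]
  -- Regrouping the summands, `P` is also the pushout of the deflation `p` along the inflation `L ↣
  -- U ⊞ B`. Thus `U ⊞ B ↠ P` has kernel `V`, and in the heart it is `α` up to isomorphism.
  have hp₃ : IsPushout (biprod.lift u g) p (biprod.desc a (biprod.inl ≫ b)) (biprod.inr ≫ b) := by
    refine IsPushout.mk' ?_ (fun T φ φ' h₁ h₂ => ?_) fun T x y e => ?_
    · rw [biprod.lift_desc, hw]; abel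
    · refine hpP.hom_ext ?_ ?_
      · simpa using biprod.inl ≫= h₁
      · ext
        · simpa using biprod.inr ≫= h₁
        · simpa using h₂
    · have e' : u ≫ biprod.inl ≫ x = biprod.lift (-g) p ≫ biprod.desc (biprod.inr ≫ x) y := by
        rw [biprod.lift_desc, ← e, biprod.lift_eq]
        simp [Preadditive.add_comp]
      exact ⟨hpP.desc _ _ e', by ext <;> simp, by simp⟩
  have hUB := H_biprod hD (H_of_U hD hU) hB
  have hn := hq.normalMono_hMap hD hUB hP
    (ExactStructure.Conf.of_isPushout hp₃ h (h'.isInflation.biprod_lift g)) hV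
  obtain ⟨e', he', -⟩ := hq.exists_iso_biprod hD hB hU hUB
  refine normalMono_of_arrow_iso hn e'.symm (hp₂.isoIsPushout _ _ hp₁) ?_
  rw [Iso.symm_hom, Iso.inv_comp_eq, he', ← Category.assoc, ← hMap_comp, biprod.inr_desc]
  simp

theorem normalEpi_of_isPullback {X B Y Z : A} {α : X ⟶ B} {β : X ⟶ Y} {γ : B ⟶ Z} {δ : Y ⟶ Z}
    (hp : IsPullback α β γ δ) (hδ : Nonempty (NormalEpi δ)) : Nonempty (NormalEpi α) := by
  obtain ⟨hδ⟩ := hδ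
  obtain ⟨Y, hY, rfl⟩ := hq.exists_obj Y
  obtain ⟨B, hB, rfl⟩ := hq.exists_obj B
  obtain ⟨L, S, hL, i, d, e, hS, h, rfl⟩ := hq.exists_conf_of_normalEpi hD hY δ hδ
  obtain ⟨g, hg⟩ := hq.hMap_surjective hB hL (γ ≫ e.inv)
  have hp₁ : IsPullback α β (hMap q hB hL g) (hMap q hY hL i) :=
    hp.of_iso (Iso.refl _) (Iso.refl _) (Iso.refl _) e.symm (by simp) (by simp) (by simp [hg])
      (by simp)
  obtain ⟨V, U, hV, hU, k, ε, h'⟩ := D.snd.exists_deflation L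
  have h' : E.Conf k ε := h'
  have hε := h'.isDeflation.biprod_desc g
  obtain ⟨_, k', w', hk'⟩ := hε
  -- Pulling back `i` along the deflation `U ⊞ B ↠ L` makes `K ↣ U ⊞ B` an inflation with cokernel
  -- `S`, which also proves `K ∈ H`. Regrouped, the same square computes the pullback in the heart.
  obtain ⟨K, m, c, k'', hpK, -, -⟩ :=
    ExactStructure.Conf.exists_pullback (E := E) ⟨w', hk'⟩ i
  have hm := ExactStructure.Conf.of_isPullback hpK h (h'.isDeflation.biprod_desc g)
  have hUB := H_biprod hD (H_of_U hD hU) hB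
  have hK := H_of_kernel hD hm hUB hS
  have hw : m ≫ biprod.fst ≫ ε + m ≫ biprod.snd ≫ g = c ≫ i := by
    rw [← hpK.w, biprod.desc_eq]; simp
  have hp₃ : IsPullback (m ≫ biprod.fst) (biprod.lift (m ≫ biprod.snd) c) ε
      (biprod.desc (-g) i) := by
    refine IsPullback.mk' ?_ (fun T φ φ' h₁ h₂ => ?_) fun T x y e => ?_
    · rw [biprod.lift_desc, ← hw]; simp
    · refine hpK.hom_ext ?_ ?_
      · ext
        · simpa using h₁
        · simpa using h₂ =≫ biprod.fst
      · simpa using h₂ =≫ biprod.snd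
    · have e' : biprod.lift x (y ≫ biprod.fst) ≫ biprod.desc ε g = (y ≫ biprod.snd) ≫ i := by
        rw [biprod.lift_desc, e, biprod.desc_eq]
        simp
      exact ⟨hpK.lift _ _ e', by simp, by ext <;> simp⟩
  have hp₂ := hq.isPullback_hMap hD hK hB hY hL h' hU hV hp₃
  have hn := hq.normalEpi_hMap hD hK hUB hm hS
  obtain ⟨e', -, he'⟩ := hq.exists_iso_biprod hD hB hU hUB
  refine normalEpi_of_arrow_iso hn (hp₂.isoIsPullback _ _ hp₁) e'.symm ?_
  rw [Iso.symm_hom, he', ← hMap_comp]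
  simp

theorem isAlmostAbelian : IsAlmostAbelian A where
  toIsPreabelian := hq.isPreabelian hD
  left _ _ _ _ hp hδ := hq.normalEpi_of_isPullback hD hp hδ
  right _ _ _ _ hp hδ := hq.normalMono_of_isPushout hD hp hδ

end IsHeartFunctor

end TwinCotorsionPair
end
end TwinCotorsion

/-! ### Integrality, tested on syzygies of objects of `S`. -/

namespace TwinCotorsion

section

variable {C : Type u} [Category.{v} C] [Preadditive C] [HasFiniteBiproducts C]
  {E : ExactStructure C} {A : Type u} [Category.{v} A] [Preadditive A]

namespace TwinCotorsionPair

variable {D : TwinCotorsionPair E}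

namespace IsHeartFunctor

variable {q : D.H.FullSubcategory ⥤ A} (hq : IsHeartFunctor q)

include hq

variable (hD : D.U ≤ D.T)

include hD

/-- Exactness of the functors represented by syzygies of objects of `S` at a pushout square. -/
theorem exists_lift_of_isProjective {X Y Z U S Q P S' : C} (hX : D.H X) (hY : D.H Y) (hZ : D.H Z)
    (hQ : D.H Q) {u : X ⟶ U} {s : U ⟶ S} {f : X ⟶ Y} {a : U ⟶ Z} {b : Y ⟶ Z} {w : Q ⟶ P}
    {π : P ⟶ S'} (h : E.Conf u s) (hp : IsPushout u f a b) (h' : E.Conf w π)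
    (hP : E.IsProjective P) (hS' : D.S S') (y : q.obj ⟨Q, hQ⟩ ⟶ q.obj ⟨Y, hY⟩)
    (hy : y ≫ hMap q hY hZ b = 0) : ∃ x, x ≫ hMap q hX hY f = y := by
  obtain ⟨y, rfl⟩ := hq.hMap_surjective _ _ y
  rw [← hMap_comp, hq.hMap_eq_zero_iff _ _ hD] at hy
  obtain ⟨U', c, d, hU', hcd⟩ := hy
  obtain ⟨c', hc'⟩ := h'.exists_extension (ext_vanishes_S_U hD hS' hU') c
  have hb := ExactStructure.Conf.of_isPushout_biprod hp h.isInflation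
  -- The composite `y ≫ b` factors through `P`. Lift `P ⟶ Z` along `U ⊞ Y ↠ Z`, whose kernel is `X`;
  -- the discrepancy then comes from `X`, so `y` agrees with `x ≫ f` up to a map through `P ∈ U`.
  obtain ⟨l, hl⟩ := hP _ hb.isDeflation (c' ≫ d)
  obtain ⟨x, hx⟩ := hb.lift (w ≫ l - y ≫ biprod.inr) (by
    rw [Preadditive.sub_comp, Category.assoc, hl, reassoc_of% hc', hcd]; simp)
  refine ⟨hMap q hQ hX x, ?_⟩
  rw [← hMap_comp, hq.hMap_eq_iff _ _ hD]
  refine ⟨P, -w, l ≫ biprod.snd, D.snd.left_of_isProjective hP, ?_⟩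
  have := hx =≫ biprod.snd
  simp only [Category.assoc, biprod.lift_snd, Preadditive.comp_neg, Preadditive.sub_comp,
    biprod.inr_snd, Category.comp_id] at this
  rw [Preadditive.neg_comp, ← eq_sub_iff_add_eq.1 this]
  abel

theorem exists_lift_of_epi {X Y Q P S : C} (hX : D.H X) (hY : D.H Y) (hQ : D.H Q) {w : Q ⟶ P}
    {π : P ⟶ S} (h : E.Conf w π) (hP : E.IsProjective P) (hS : D.S S)
    (f : q.obj ⟨X, hX⟩ ⟶ q.obj ⟨Y, hY⟩) (hf : Epi f) (y : q.obj ⟨Q, hQ⟩ ⟶ q.obj ⟨Y, hY⟩) :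
    ∃ x, x ≫ f = y := by
  obtain ⟨f, rfl⟩ := hq.hMap_surjective _ _ f
  obtain ⟨U, S', u, s, hU, hS', h'⟩ := (H_iff hD).1 hX
  obtain ⟨Z, a, b, d, hp, hc, -⟩ := h'.exists_pushout f
  have hZ := H_of_inflation hD hc hY hS'
  -- The map `b` is the cokernel of the epimorphism `f`, so every `y` satisfies the condition for
  -- lifting.
  have hb : hMap q hY hZ b = 0 := by
    rw [← cancel_epi (hMap q hX hY f), hq.hMap_comp_eq_zero hD hX hY hZ hU u a hp.w, comp_zero]
  exact hq.exists_lift_of_isProjective hD hX hY hZ hQ h' hp h hP hS y (by rw [hb, comp_zero])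

/-- Every object of the heart is covered by a syzygy of an object of `S`. -/
theorem exists_epi (hP : E.EnoughProjectives) {X : C} (hX : D.H X) :
    ∃ (Q P S : C) (hQ : D.H Q) (w : Q ⟶ P) (π : P ⟶ S) (c : q.obj ⟨Q, hQ⟩ ⟶ q.obj ⟨X, hX⟩),
      E.Conf w π ∧ E.IsProjective P ∧ D.S S ∧ Epi c := by
  obtain ⟨U, S, u, s, hU, hS, h⟩ := (H_iff hD).1 hX
  obtain ⟨P, π, hP, Q, w, w', h'⟩ := hP S
  have h' : E.Conf w π := ⟨w', h'⟩
  have hQ : D.H Q := (H_iff hD).2 ⟨P, S, w, π, D.snd.left_of_isProjective hP, hS, h'⟩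
  obtain ⟨m, hm⟩ := hP s h.isDeflation π
  obtain ⟨c, hc⟩ := h.lift (w ≫ m) (by rw [Category.assoc, hm, h'.w])
  refine ⟨Q, P, S, hQ, w, π, hMap q hQ hX c, h', hP, hS,
    Preadditive.epi_of_cancel_zero _ fun {T} y hy => ?_⟩
  obtain ⟨Y, hY, rfl⟩ := hq.exists_obj T
  obtain ⟨y, rfl⟩ := hq.hMap_surjective _ _ y
  rw [← hMap_comp, hq.hMap_eq_zero_iff _ _ hD] at hy
  obtain ⟨U', a, b, hU', hab⟩ := hy
  obtain ⟨a', ha'⟩ := h'.exists_extension (ext_vanishes_S_U hD hS hU') a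
  -- The pushout of `X ↣ U ↠ S` along `y` splits: correcting `P ⟶ U ⟶ Z` by a map through `Y` makes
  -- it vanish on `Q` and induces a section. A retraction `Z ⟶ Y` then factors `y` through `U`.
  obtain ⟨Z, y', i, d, hp, hi, hd⟩ := h.exists_pushout y
  obtain ⟨t, ht⟩ := h'.desc (m ≫ y' - a' ≫ b ≫ i) (by
    rw [Preadditive.comp_sub, reassoc_of% ha', ← reassoc_of% hc, reassoc_of% hab, hp.w, sub_self])
  have := h'.epi
  have := hi.mono
  have htd : t ≫ d = 𝟙 S := by
    rw [← cancel_epi π, reassoc_of% ht, Preadditive.sub_comp, Category.assoc, hd, hm,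
      Category.assoc, Category.assoc, hi.w]
    simp
  obtain ⟨r, hr⟩ := hi.lift (𝟙 Z - d ≫ t) (by
    rw [Preadditive.sub_comp, Category.assoc, htd]; simp)
  have hir : i ≫ r = 𝟙 Y := by
    rw [← cancel_mono i, Category.assoc, hr, Preadditive.comp_sub, reassoc_of% hi.w]
    simp
  rw [hq.hMap_eq_zero_iff _ _ hD]
  exact ⟨U, u, y' ≫ r, hU, by rw [hp.w_assoc, hir, Category.comp_id]⟩

/-- Cover `B` by a syzygy `Q`. The map `Q ⟶ Z` lifts along `δ`, so the cover factors through `α`. -/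
theorem epi_of_isPullback (hE : E.EnoughProjectives) {X B Y Z : A} {α : X ⟶ B} {β : X ⟶ Y}
    {γ : B ⟶ Z} {δ : Y ⟶ Z} (hp : IsPullback α β γ δ) (hδ : Epi δ) : Epi α := by
  obtain ⟨B, hB, rfl⟩ := hq.exists_obj B
  obtain ⟨Y, hY, rfl⟩ := hq.exists_obj Y
  obtain ⟨Z, hZ, rfl⟩ := hq.exists_obj Z
  obtain ⟨Q, P, S, hQ, w, π, c, h, hP, hS, hc⟩ := hq.exists_epi hD hE hB
  obtain ⟨t, ht⟩ := hq.exists_lift_of_epi hD hY hZ hQ h hP hS δ hδ (c ≫ γ)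
  exact epi_of_epi_fac (hp.lift_fst c t ht.symm)

theorem mono_of_isPushout (hE : E.EnoughProjectives) {X B Y Z : A} {α : B ⟶ X} {β : Y ⟶ X}
    {γ : Z ⟶ B} {δ : Z ⟶ Y} (hp : IsPushout γ δ α β) (hδ : Mono δ) : Mono α := by
  obtain ⟨B, hB, rfl⟩ := hq.exists_obj B
  obtain ⟨Y, hY, rfl⟩ := hq.exists_obj Y
  obtain ⟨L, hL, rfl⟩ := hq.exists_obj Z
  obtain ⟨f, rfl⟩ := hq.hMap_surjective _ _ γ
  obtain ⟨g, rfl⟩ := hq.hMap_surjective _ _ δ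
  obtain ⟨U, S, u, s, hU, hS, h⟩ := (H_iff hD).1 hL
  obtain ⟨Z, a, b, d, hpZ, hc, -⟩ := h.exists_pushout (biprod.lift (-f) g)
  have hBY := H_biprod hD hB hY
  have hZ := H_of_inflation hD hc hBY hS
  have hp' := hq.isPushout_hMap hD hL hB hY hZ h hU hS hpZ
  refine Preadditive.mono_of_cancel_zero _ fun {T} y hy => ?_
  obtain ⟨T, hT, rfl⟩ := hq.exists_obj T
  obtain ⟨Q, P, S', hQ, w, π, c, h', hP, hS', hc'⟩ := hq.exists_epi hD hE hT
  have hy' : y ≫ hMap q hB hZ (biprod.inl ≫ b) = 0 := by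
    rw [← hp.inl_isoIsPushout_hom _ _ hp', reassoc_of% hy, zero_comp]
  -- On the cover `Q`, the element `(y, 0)` of `B ⊞ Y` dies in the pushout, so it is the image of
  -- some `x` in `L`. Its second coordinate forces `x = 0` because `δ` is mono.
  obtain ⟨x, hx⟩ := hq.exists_lift_of_isProjective hD hL hBY hZ hQ h hpZ h' hP hS'
    (c ≫ y ≫ hMap q hB hBY biprod.inl) (by
      rw [Category.assoc, Category.assoc, ← hMap_comp, hy', comp_zero])
  have hx₁ := hx =≫ hMap q hBY hB biprod.fst
  have hx₂ := hx =≫ hMap q hBY hY biprod.snd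
  simp only [Category.assoc, ← hMap_comp, biprod.lift_fst, biprod.lift_snd, biprod.inl_fst,
    biprod.inl_snd, hq.hMap_zero, comp_zero, hMap_id, Category.comp_id] at hx₁ hx₂
  have hx₀ : x = 0 := by rw [← cancel_mono (hMap q hL hY g), hx₂, zero_comp]
  rw [← cancel_epi c, ← hx₁, hx₀, zero_comp, comp_zero]

theorem isIntegral (hE : E.EnoughProjectives) : IsIntegral A where
  toIsPreabelian := hq.isPreabelian hD
  left _ _ _ _ hp hδ := hq.epi_of_isPullback hD hE hp hδ
  right _ _ _ _ hp hδ := hq.mono_of_isPushout hD hE hp hδ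

end IsHeartFunctor

end TwinCotorsionPair
end
end TwinCotorsion

/-! ### Duality, and the reduction of `T ⊆ U` to `U ⊆ T`. -/

namespace TwinCotorsion

section

open Opposite

variable {C : Type u} [Category.{v} C] [Preadditive C] [HasFiniteBiproducts C]

instance hasFiniteBiproducts_op : HasFiniteBiproducts Cᵒᵖ :=
  HasFiniteBiproducts.of_hasFiniteProducts

/-- Biproducts in the opposite category. -/
noncomputable def biprodUnopIso (X Y : Cᵒᵖ) : unop (X ⊞ Y) ≅ unop X ⊞ unop Y where
  hom := biprod.lift (biprod.inl : X ⟶ X ⊞ Y).unop (biprod.inr : Y ⟶ X ⊞ Y).unop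
  inv := biprod.desc (biprod.fst : X ⊞ Y ⟶ X).unop (biprod.snd : X ⊞ Y ⟶ Y).unop
  hom_inv_id := by
    rw [biprod.lift_desc, ← unop_comp, ← unop_comp, ← unop_add, biprod.total, unop_id]
  inv_hom_id := by
    ext <;> simp [← unop_comp]

theorem biprodUnopIso_naturality {X Y X' Y' : Cᵒᵖ} (f : X ⟶ X') (g : Y ⟶ Y') :
    (biprodUnopIso X' Y').hom ≫ biprod.map f.unop g.unop =
      (biprod.map f g).unop ≫ (biprodUnopIso X Y).hom := by
  ext <;> simp [biprodUnopIso, ← unop_comp]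

theorem biprod_map_comp_map {X Y Z X' Y' Z' : C} {f : X ⟶ Y} {g : Y ⟶ Z} {f' : X' ⟶ Y'}
    {g' : Y' ⟶ Z'} (h : f ≫ g = 0) (h' : f' ≫ g' = 0) :
    biprod.map f f' ≫ biprod.map g g' = 0 := by
  ext <;> simp [reassoc_of% h, reassoc_of% h']

namespace ExactStructure

variable (E : ExactStructure C)

theorem isInflation_unop_iff {X Y : Cᵒᵖ} (d : X ⟶ Y) :
    (∃ (Z : Cᵒᵖ) (i : Z ⟶ X) (w : i ≫ d = 0), E.conflation (ShortComplex.mk i d w).unop) ↔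
      E.IsInflation d.unop :=
  ⟨fun ⟨_, i, w, h⟩ => ⟨_, i.unop, congrArg Quiver.Hom.unop w, h⟩,
    fun ⟨_, i, w, h⟩ => ⟨_, i.op, congrArg Quiver.Hom.op w, h⟩⟩

theorem isDeflation_unop_iff {X Y : Cᵒᵖ} (i : X ⟶ Y) :
    (∃ (Z : Cᵒᵖ) (d : Y ⟶ Z) (w : i ≫ d = 0), E.conflation (ShortComplex.mk i d w).unop) ↔
      E.IsDeflation i.unop :=
  ⟨fun ⟨_, d, w, h⟩ => ⟨_, d.unop, congrArg Quiver.Hom.unop w, h⟩,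
    fun ⟨_, d, w, h⟩ => ⟨_, d.op, congrArg Quiver.Hom.op w, h⟩⟩

theorem directSum_unop_iff (S₁ S₂ : ShortComplex Cᵒᵖ) :
    E.conflation (ShortComplex.mk (biprod.map S₁.f S₂.f) (biprod.map S₁.g S₂.g)
      (biprod_map_comp_map S₁.zero S₂.zero)).unop ↔
    E.conflation (ShortComplex.mk (biprod.map S₁.unop.f S₂.unop.f)
      (biprod.map S₁.unop.g S₂.unop.g) (biprod_map_comp_map S₁.unop.zero S₂.unop.zero)) :=
  have e : (ShortComplex.mk (biprod.map S₁.f S₂.f) (biprod.map S₁.g S₂.g)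
      (biprod_map_comp_map S₁.zero S₂.zero)).unop ≅
      ShortComplex.mk (biprod.map S₁.unop.f S₂.unop.f) (biprod.map S₁.unop.g S₂.unop.g)
        (biprod_map_comp_map S₁.unop.zero S₂.unop.zero) :=
    ShortComplex.isoMk (biprodUnopIso _ _) (biprodUnopIso _ _) (biprodUnopIso _ _)
      (biprodUnopIso_naturality _ _) (biprodUnopIso_naturality _ _)
  ⟨E.of_iso e, E.of_iso e.symm⟩

/-- The opposite of an exact structure. -/
def op : ExactStructure Cᵒᵖ where
  conflation S := E.conflation S.unop
  isKernel S h := by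
    have h' : E.Conf S.unop.f S.unop.g := ⟨S.unop.zero, h⟩
    have : Mono S.f := by
      rw [← Quiver.Hom.op_unop S.f]; exact @op_mono_of_epi _ _ _ _ S.f.unop h'.epi
    refine ⟨KernelFork.IsLimit.ofι' _ _ fun g hg => ⟨_, Exists.choose_spec (?_ : ∃ l, l ≫ _ = g)⟩⟩
    obtain ⟨l, hl⟩ := h'.desc g.unop (congrArg Quiver.Hom.unop hg)
    exact ⟨l.op, congrArg Quiver.Hom.op hl⟩
  isCokernel S h := by
    have h' : E.Conf S.unop.f S.unop.g := ⟨S.unop.zero, h⟩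
    have : Epi S.g := by
      rw [← Quiver.Hom.op_unop S.g]; exact @op_epi_of_mono _ _ _ _ S.g.unop h'.mono
    refine ⟨CokernelCofork.IsColimit.ofπ' _ _ fun g hg =>
      ⟨_, Exists.choose_spec (?_ : ∃ l, _ ≫ l = g)⟩⟩
    obtain ⟨l, hl⟩ := h'.lift g.unop (congrArg Quiver.Hom.unop hg)
    exact ⟨l.op, congrArg Quiver.Hom.op hl⟩
  of_iso e h := E.of_iso
    ⟨ShortComplex.unopMap e.inv, ShortComplex.unopMap e.hom,
      congrArg ShortComplex.unopMap e.hom_inv_id, congrArg ShortComplex.unopMap e.inv_hom_id⟩ h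
  directSum S₁ S₂ h₁ h₂ := (E.directSum_unop_iff S₁ S₂).2 (E.directSum _ _ h₁ h₂)
  directSummand S₁ S₂ h := E.directSummand _ _ ((E.directSum_unop_iff S₁ S₂).1 h)
  id_inflation X := (E.isDeflation_unop_iff (𝟙 X)).2 (E.id_deflation X.unop)
  id_deflation X := (E.isInflation_unop_iff (𝟙 X)).2 (E.id_inflation X.unop)
  comp_inflation i j hi hj := (E.isDeflation_unop_iff (i ≫ j)).2
    (E.comp_deflation _ _ ((E.isDeflation_unop_iff j).1 hj) ((E.isDeflation_unop_iff i).1 hi))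
  comp_deflation i j hi hj := (E.isInflation_unop_iff (i ≫ j)).2
    (E.comp_inflation _ _ ((E.isInflation_unop_iff j).1 hj) ((E.isInflation_unop_iff i).1 hi))
  pullback_deflation S h Z' f := by
    obtain ⟨Y', g', i', hp, hi⟩ := E.pushout_inflation S.unop h f.unop
    exact ⟨Opposite.op Y', g'.op, i'.op, hp.op.flip, (E.isInflation_unop_iff i'.op).2 hi⟩
  pushout_inflation S h X' g := by
    obtain ⟨Y', g', i', hp, hi⟩ := E.pullback_deflation S.unop h g.unop
    exact ⟨Opposite.op Y', g'.op, i'.op, hp.op.flip, (E.isDeflation_unop_iff i'.op).2 hi⟩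

variable {E}

theorem hasConflation_op {X Y Z : C} (h : E.HasConflation X Y Z) :
    E.op.HasConflation (Opposite.op Z) (Opposite.op Y) (Opposite.op X) := by
  obtain ⟨i, d, w, h⟩ := h
  exact ⟨d.op, i.op, congrArg Quiver.Hom.op w, h⟩

theorem hasConflation_unop {X Y Z : Cᵒᵖ} (h : E.op.HasConflation X Y Z) :
    E.HasConflation (unop Z) (unop Y) (unop X) := by
  obtain ⟨i, d, w, h⟩ := h
  exact ⟨d.unop, i.unop, congrArg Quiver.Hom.unop w, h⟩

theorem extVanishes_op {X Y : Cᵒᵖ} (h : E.ExtVanishes (unop Y) (unop X)) :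
    E.op.ExtVanishes X Y := fun _ i d w hc =>
  (h _ d.unop i.unop (congrArg Quiver.Hom.unop w) hc).map fun s => s.op

theorem enoughProjectives_op (hE : E.EnoughInjectives) : E.op.EnoughProjectives := fun X => by
  obtain ⟨I, i, hI, hi⟩ := hE X.unop
  refine ⟨Opposite.op I, i.op, fun f hf g => ?_, (E.isInflation_unop_iff i.op).2 hi⟩
  obtain ⟨l, hl⟩ := hI f.unop ((E.isInflation_unop_iff f).1 hf) g.unop
  exact ⟨l.op, congrArg Quiver.Hom.op hl⟩

end ExactStructure

theorem IsAdditiveSubcategory.op {P : ObjectProperty C} (hP : IsAdditiveSubcategory P) :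
    IsAdditiveSubcategory P.op where
  zero := by
    obtain ⟨Z, hZ, h⟩ := hP.zero
    exact ⟨Opposite.op Z, hZ.op, h⟩
  biprod X Y hX hY := hP.of_iso (biprodUnopIso X Y).symm (hP.biprod _ _ hX hY)
  summand X Y Z e hZ := by
    obtain ⟨e⟩ := e
    exact hP.summand _ (unop Y) _ ⟨e.unop.symm ≪≫ biprodUnopIso X Y⟩ hZ

variable {E : ExactStructure C}

/-- The opposite of a cotorsion pair. -/
def CotorsionPair.op (P : CotorsionPair E) : CotorsionPair E.op where
  left := P.right.op
  right := P.left.op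
  additive_left := P.additive_right.op
  additive_right := P.additive_left.op
  ext_vanishes X Y hX hY := ExactStructure.extVanishes_op (P.ext_vanishes _ _ hY hX)
  exists_deflation X := by
    obtain ⟨V, U, hV, hU, h⟩ := P.exists_inflation X.unop
    exact ⟨_, _, hU, hV, ExactStructure.hasConflation_op h⟩
  exists_inflation X := by
    obtain ⟨V, U, hV, hU, h⟩ := P.exists_deflation X.unop
    exact ⟨_, _, hU, hV, ExactStructure.hasConflation_op h⟩

namespace TwinCotorsionPair

variable (D : TwinCotorsionPair E)

/-- `T` contains every object right orthogonal to `S`, and `S ⊆ U`. This is the inclusion needed for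
the opposite to be a twin pair. -/
theorem V_le_T : D.V ≤ D.T := fun _ hX =>
  D.fst.right_of_extVanishes fun _ hS => ext_vanishes_S_V hS hX

/-- The opposite of a twin cotorsion pair. -/
def op : TwinCotorsionPair E.op where
  fst := D.snd.op
  snd := D.fst.op
  le _ hX := D.V_le_T _ hX

theorem W_op_iff {X : Cᵒᵖ} : D.op.W X ↔ D.W (unop X) := And.comm

theorem H_op_iff {X : Cᵒᵖ} : D.op.H X ↔ D.H (unop X) := by
  constructor
  · rintro ⟨⟨V, W, hV, hW, h⟩, ⟨W', S, hW', hS, h'⟩⟩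
    exact ⟨⟨_, _, hS, D.W_op_iff.1 hW', ExactStructure.hasConflation_unop h'⟩,
      ⟨_, _, D.W_op_iff.1 hW, hV, ExactStructure.hasConflation_unop h⟩⟩
  · rintro ⟨⟨V, W, hV, hW, h⟩, ⟨W', S, hW', hS, h'⟩⟩
    exact ⟨⟨_, _, hS, D.W_op_iff.2 hW', ExactStructure.hasConflation_op h'⟩,
      ⟨_, _, D.W_op_iff.2 hW, hV, ExactStructure.hasConflation_op h⟩⟩

theorem functor_map_eq_zero_iff {X Y : D.H.FullSubcategory} (f : X ⟶ Y) :
    (CategoryTheory.Quotient.functor D.heartRel).map f = 0 ↔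
      ∃ (Z : C) (a : X.obj ⟶ Z) (b : Z ⟶ Y.obj), D.W Z ∧ a ≫ b = f.hom := by
  refine (CategoryTheory.Quotient.functor_map_eq_iff D.heartRel f 0).trans ?_
  have : f.hom - (0 : X ⟶ Y).hom = f.hom := sub_zero _
  simp only [heartRel, this]

theorem isHeartFunctor : D.IsHeartFunctor (CategoryTheory.Quotient.functor D.heartRel) where
  map_add _ _ := rfl
  map_surjective _ _ f := Functor.map_surjective _ f
  obj_surjective X := ⟨X.as, rfl⟩
  map_eq_zero_iff := D.functor_map_eq_zero_iff

/-- The functor from the objects of `H` in the opposite category to the opposite of the heart. -/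
def opFunctor : D.op.H.FullSubcategory ⥤ (D.Heart)ᵒᵖ where
  obj X := Opposite.op ((CategoryTheory.Quotient.functor D.heartRel).obj
    ⟨unop X.obj, D.H_op_iff.1 X.property⟩)
  map {X Y} f := ((CategoryTheory.Quotient.functor D.heartRel).map
    (X := ⟨unop Y.obj, D.H_op_iff.1 Y.property⟩) (Y := ⟨unop X.obj, D.H_op_iff.1 X.property⟩)
    (ObjectProperty.homMk f.hom.unop)).op
  map_id _ := rfl
  map_comp _ _ := rfl

/-- This lets all results on the heart apply directly to the opposite of `D.Heart`, without
comparing it with the quotient category built from `D.op`. -/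
theorem isHeartFunctor_opFunctor : D.op.IsHeartFunctor D.opFunctor where
  map_add _ _ := rfl
  map_surjective X Y f := by
    obtain ⟨g, hg⟩ := Functor.map_surjective (CategoryTheory.Quotient.functor D.heartRel)
      (X := ⟨unop Y.obj, D.H_op_iff.1 Y.property⟩) (Y := ⟨unop X.obj, D.H_op_iff.1 X.property⟩)
      (show (CategoryTheory.Quotient.functor D.heartRel).obj ⟨unop Y.obj, _⟩ ⟶
        (CategoryTheory.Quotient.functor D.heartRel).obj ⟨unop X.obj, _⟩ from f.unop)
    exact ⟨ObjectProperty.homMk g.hom.op, congrArg Quiver.Hom.op hg⟩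
  obj_surjective X := ⟨⟨Opposite.op X.unop.as.obj, D.H_op_iff.2 X.unop.as.property⟩, rfl⟩
  map_eq_zero_iff {X Y} f := by
    have := D.functor_map_eq_zero_iff (X := ⟨unop Y.obj, D.H_op_iff.1 Y.property⟩)
      (Y := ⟨unop X.obj, D.H_op_iff.1 X.property⟩) (ObjectProperty.homMk f.hom.unop)
    refine (Iff.trans ?_ this).trans ?_
    · exact ⟨fun h => congrArg Quiver.Hom.unop h, fun h => congrArg Quiver.Hom.op h⟩
    · constructor
      · rintro ⟨Z, a, b, hZ, h⟩
        exact ⟨Opposite.op Z, b.op, a.op, D.W_op_iff.2 hZ, congrArg Quiver.Hom.op h⟩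
      · rintro ⟨Z, a, b, hZ, h⟩
        exact ⟨unop Z, b.unop, a.unop, D.W_op_iff.1 hZ, congrArg Quiver.Hom.unop h⟩

end TwinCotorsionPair

section

variable {A : Type u} [Category.{v} A] [Preadditive A]

theorem IsPreabelian.of_op (h : IsPreabelian Aᵒᵖ) : IsPreabelian A where
  hasFiniteBiproducts := by
    have := h.hasFiniteBiproducts
    have : HasFiniteProducts Aᵒᵖ := inferInstance
    have : HasFiniteCoproducts A := hasFiniteCoproducts_of_opposite
    exact HasFiniteBiproducts.of_hasFiniteCoproducts
  hasKernels := ⟨fun f => by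
    have := h.hasCokernels
    refine ⟨⟨⟨KernelFork.ofι (cokernel.π f.op).unop (congrArg Quiver.Hom.unop
      (cokernel.condition f.op)), ?_⟩⟩⟩
    have : Mono (cokernel.π f.op).unop := unop_mono_of_epi _
    exact KernelFork.IsLimit.ofι' _ _ fun g hg =>
      ⟨(cokernel.desc f.op g.op (congrArg Quiver.Hom.op hg)).unop,
        congrArg Quiver.Hom.unop (cokernel.π_desc f.op g.op (congrArg Quiver.Hom.op hg))⟩⟩
  hasCokernels := ⟨fun f => by
    have := h.hasKernels
    refine ⟨⟨⟨CokernelCofork.ofπ (kernel.ι f.op).unop (congrArg Quiver.Hom.unop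
      (kernel.condition f.op)), ?_⟩⟩⟩
    have : Epi (kernel.ι f.op).unop := unop_epi_of_mono _
    exact CokernelCofork.IsColimit.ofπ' _ _ fun g hg =>
      ⟨(kernel.lift f.op g.op (congrArg Quiver.Hom.op hg)).unop,
        congrArg Quiver.Hom.unop (kernel.lift_ι f.op g.op (congrArg Quiver.Hom.op hg))⟩⟩

theorem nonempty_normalEpi_op {X Y : A} {f : X ⟶ Y} (h : Nonempty (NormalMono f)) :
    Nonempty (NormalEpi f.op) := h.map fun h => normalEpiOfNormalMonoUnop f.op h

theorem nonempty_normalMono_op {X Y : A} {f : X ⟶ Y} (h : Nonempty (NormalEpi f)) :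
    Nonempty (NormalMono f.op) := h.map fun h => normalMonoOfNormalEpiUnop f.op h

theorem nonempty_normalEpi_of_op {X Y : A} {f : X ⟶ Y} (h : Nonempty (NormalMono f.op)) :
    Nonempty (NormalEpi f) := by
  obtain ⟨Z, g, w, hl⟩ := h
  have : Epi f := by
    have : Mono f.op := mono_of_isLimit_fork hl
    exact unop_epi_of_mono f.op
  refine ⟨⟨_, g.unop, congrArg Quiver.Hom.unop w, CokernelCofork.IsColimit.ofπ' _ _ fun k hk => ?_⟩⟩
  have l := KernelFork.IsLimit.lift' hl k.op (congrArg Quiver.Hom.op hk)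
  exact ⟨l.1.unop, congrArg Quiver.Hom.unop l.2⟩

theorem nonempty_normalMono_of_op {X Y : A} {f : X ⟶ Y} (h : Nonempty (NormalEpi f.op)) :
    Nonempty (NormalMono f) := by
  obtain ⟨Z, g, w, hl⟩ := h
  have : Mono f := by
    have : Epi f.op := epi_of_isColimit_cofork hl
    exact unop_mono_of_epi f.op
  refine ⟨⟨_, g.unop, congrArg Quiver.Hom.unop w, KernelFork.IsLimit.ofι' _ _ fun k hk => ?_⟩⟩
  have l := CokernelCofork.IsColimit.desc' hl k.op (congrArg Quiver.Hom.op hk)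
  exact ⟨l.1.unop, congrArg Quiver.Hom.unop l.2⟩

theorem IsIntegral.of_op (h : IsIntegral Aᵒᵖ) : IsIntegral A where
  toIsPreabelian := h.toIsPreabelian.of_op
  left α _ _ δ hp _ := by
    have : Mono α.op := h.right _ _ _ δ.op hp.op.flip (inferInstanceAs (Mono δ.op))
    exact unop_epi_of_mono α.op
  right α _ _ δ hp _ := by
    have : Epi α.op := h.left _ _ _ δ.op hp.op.flip (inferInstanceAs (Epi δ.op))
    exact unop_mono_of_epi α.op

theorem IsAlmostAbelian.of_op (h : IsAlmostAbelian Aᵒᵖ) : IsAlmostAbelian A where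
  toIsPreabelian := h.toIsPreabelian.of_op
  left _ _ _ δ hp hδ := nonempty_normalEpi_of_op
    (h.right _ _ _ δ.op hp.op.flip (nonempty_normalMono_op hδ))
  right _ _ _ δ hp hδ := nonempty_normalMono_of_op
    (h.left _ _ _ δ.op hp.op.flip (nonempty_normalEpi_op hδ))

end

end

end TwinCotorsion

theorem theorem7 {C : Type u} [Category.{v} C] [Preadditive C] [HasFiniteBiproducts C]
    (E : TwinCotorsion.ExactStructure C) (hKS : TwinCotorsion.IsKrullSchmidt C)
    (hP : E.EnoughProjectives) (hI : E.EnoughInjectives)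
    (D : TwinCotorsion.TwinCotorsionPair E) (hD : D.U ≤ D.T ∨ D.T ≤ D.U) :
    TwinCotorsion.IsIntegral D.Heart ∧ TwinCotorsion.IsAlmostAbelian D.Heart := by
  rcases hD with hD | hD
  · exact ⟨D.isHeartFunctor.isIntegral hD hP, D.isHeartFunctor.isAlmostAbelian hD⟩
  -- In the opposite twin pair the roles of `U` and `T` are played by `Tᵒᵖ` and `Uᵒᵖ`.
  · have hD' : D.op.U ≤ D.op.T := fun X hX => hD _ hX
    exact ⟨.of_op (D.isHeartFunctor_opFunctor.isIntegral hD'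
        (TwinCotorsion.ExactStructure.enoughProjectives_op hI)),
      .of_op (D.isHeartFunctor_opFunctor.isAlmostAbelian hD')⟩
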